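/- Let $F_i(y)=q_i+\tfrac12(y-q_i)$, $i=0,1,2$, where $q_0,q_1,q_2$ are the vertices of an equilateral triangle in the plane. Let $\mathcal{SG}$ be the Sierpinski gasket, i.e. the unique nonempty compact set with $\mathcal{SG}=\bigcup_i F_i(\mathcal{SG})$. Put $V_0=\{q_0,q_1,q_2\}$; for a word $w=(w_1,\dots,w_m)$ put $F_w=F_{w_1}\circ\cdots\circ F_{w_m}$; call $F_w(\mathcal{SG})$ an $m$-cell, with boundary points $F_wq_0,F_wq_1,F_wq_2$. Let $V_m=\bigcup_{|w|=m}F_w(V_0)$, and write $y\sim_m z$ if $y\ne z$ are boundary points of a common $m$-cell. Let $\mu$ be the self-similar probability measure on $\mathcal{SG}$ that gives mass $3^{-m}$ to each $m$-cell. *Laplacian.* Let $\mathcal E_m(u,v)=(3/5)^{-m}\sum_{y\sim_m z}(u(y)-u(z))(v(y)-v(z))$ (each edge counted once) and $\mathcal E(u,v)=\lim_{m\to\infty}\mathcal E_m(u,v)$; $\mathrm{dom}\,\mathcal E$ consists of the continuous real functions $u$ on $\mathcal{SG}$ with $\lim_m\mathcal E_m(u,u)<\infty$. We say $u\in\mathrm{dom}\,\Delta$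 with $\Delta u=f$ if $f$ is continuous on $\mathcal{SG}$, $u\in\mathrm{dom}\,\mathcal E$, and $\mathcal E(u,v)=-\int fv\,d\mu$ for all $v\in\mathrm{dom}\,\mathcal E$ with $v|_{V_0}=0$. A continuous function $h$ on $\mathcal{SG}$ is harmonic if $h(y)=\frac14\sum_{z\sim_m y}h(z)$ for all $m$ and all $y\in V_m\setminus V_0$. *Mean value neighborhoods.* For $B\subset\mathcal{SG}$ with $\mu(B)>0$ let $M_B(u)=\mu(B)^{-1}\int_B u\,d\mu$. Let $C_w=F_w(\mathcal{SG})$ be a $k$-cell not meeting $V_0$, with boundary points $p_i=F_wq_i$; let $C_i$ be the other $k$-cell having $p_i$ as a boundary point, and let $\rho$ be the distance from $p_i$ to the line through the other two boundary points of $C_i$ (the same for all $i$). For $0\le c_0,c_1,c_2\le1$ let $B(c_0,c_1,c_2)=C_w\cup E_0\cup E_1\cup E_2$, where $E_i$ is the part of $C_i$ that lies, on the side of $p_i$, on or before the line perpendicular to the symmetry axis of $C_i$ through $p_i$ at distance $c_i\rho$ from $p_i$ (so $E_i=\{p_i\}$ for $c_i=0$ and $E_i=C_i$ for $c_i=1$).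 A set $B$ is a $k$ level mean value neighborhood of $x$ if $B=B(c_0,c_1,c_2)$ for some such $C_w\ni x$ and some $c_i\in[0,1]$, and $M_B(h)=h(x)$ for every harmonic function $h$. For such $B$ put $c_B=M_B(v)-v(x)$, where $v\in\mathrm{dom}\,\Delta$ is any function with $\Delta v\equiv1$. **Theorem 4.2.** Let $u\in\mathrm{dom}\,\Delta$, and suppose that $g=\Delta u$ satisfies, for some constants $c$ and $0<\gamma<1$, $|g(y)-g(z)|\le c\gamma^k$ for all $k\ge0$ and all $y,z$ belonging to the same $k$-cell. Let $x\in\mathcal{SG}\setminus V_0$, and for each $k\ge k_0$ let $B_k(x)$ be a $k$ level mean value neighborhood of $x$. Then $c_{B_k(x)}\ne0$ for all $k\ge k_0$, and $$\lim_{k\to\infty}\frac{1}{c_{B_k(x)}}\bigl(M_{B_k(x)}(u)-u(x)\bigr)=\Delta u(x).$$ -/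

import Mathlib

open MeasureTheory Filter Topology Set

noncomputable section

namespace SG

/-- The Euclidean plane. -/
abbrev Plane : Type := EuclideanSpace ℝ (Fin 2)

/-- `q 0, q 1, q 2` are the three vertices of a (nondegenerate) equilateral triangle. -/
def Equilateral (q : Fin 3 → Plane) : Prop :=
  ∃ l : ℝ, 0 < l ∧ ∀ i j, i ≠ j → dist (q i) (q j) = l

/-- The homothety `F_i` with contraction ratio `1/2` and fixed point `q i`. -/
def F (q : Fin 3 → Plane) (i : Fin 3) (x : Plane) : Plane :=
  q i + (1 / 2 : ℝ) • (x - q i)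

/-- `F_w = F_{w_1} ∘ ⋯ ∘ F_{w_m}` for a word `w = (w_1, …, w_m)`. -/
def wordMap (q : Fin 3 → Plane) : List (Fin 3) → Plane → Plane
  | [] => id
  | i :: w => F q i ∘ wordMap q w

/-- The point with address `ω = (ω_1, ω_2, …)`, that is, the limit of `F_{ω_1} ∘ ⋯ ∘ F_{ω_n} (y)`
as `n → ∞` (for any `y`), which is `∑ n ≥ 1, 2^{-n} q_{ω_n}`. -/
def coding (q : Fin 3 → Plane) (ω : ℕ → Fin 3) : Plane :=
  ∑' n, (1 / 2 : ℝ) ^ (n + 1) • q (ω n)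

/-- The Sierpinski gasket: the set of all points that have an address. By
`isCompact_gasket`, `gasket_nonempty`, `gasket_eq_iUnion` and `eq_gasket` below it is the unique
nonempty compact set `K` with `K = ⋃ i, F_i (K)`. -/
def gasket (q : Fin 3 → Plane) : Set Plane := Set.range (coding q)

/-- The cell `F_w (SG)`; it is an `m`-cell if `w` has length `m`. -/
def cell (q : Fin 3 → Plane) (w : List (Fin 3)) : Set Plane := wordMap q w '' gasket q

/-- The uniform probability measure on the three letters. -/
def letterMeasure : Measure (Fin 3) := (PMF.uniformOfFintype (Fin 3)).toMeasure

instance : IsProbabilityMeasure letterMeasure := by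
  unfold letterMeasure; infer_instance

/-- The self-similar probability measure on the gasket (as a measure on the plane, carried by the
gasket) which gives mass `3^{-m}` to each `m`-cell: the law of the point whose address consists of
independent uniformly distributed letters. -/
def mu (q : Fin 3 → Plane) : Measure Plane :=
  (Measure.infinitePi fun _ : ℕ => letterMeasure).map (coding q)

/-- The vertex set `V_m` of the graph `Γ_m`; in particular `V_0 = {q_0, q_1, q_2}`. -/
def V (q : Fin 3 → Plane) (m : ℕ) : Set Plane :=
  {x | ∃ w : List (Fin 3), w.length = m ∧ ∃ i, x = wordMap q w (q i)}

/-- The edge relation `x ∼_m y` of `Γ_m`: distinct boundary points of a common `m`-cell. -/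
def Adj (q : Fin 3 → Plane) (m : ℕ) (x y : Plane) : Prop :=
  x ≠ y ∧ ∃ w : List (Fin 3), w.length = m ∧ ∃ i j, x = wordMap q w (q i) ∧ y = wordMap q w (q j)

/-- The (polarized) renormalized graph energy
`𝓔_m(u, v) = (3/5)^{-m} ∑_{x ∼_m y} (u x - u y) (v x - v y)`, each edge counted once.
Each edge of `Γ_m` lies in exactly one `m`-cell, and the edges are summed cell by cell;
the factor `1/2` compensates that each edge of a cell is met as `(i, j)` and as `(j, i)`. -/
def graphEnergy (q : Fin 3 → Plane) (m : ℕ) (u v : Plane → ℝ) : ℝ :=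
  (5 / 3 : ℝ) ^ m * ∑ w : Fin m → Fin 3, (1 / 2 : ℝ) * ∑ i, ∑ j,
    (u (wordMap q (List.ofFn w) (q i)) - u (wordMap q (List.ofFn w) (q j))) *
    (v (wordMap q (List.ofFn w) (q i)) - v (wordMap q (List.ofFn w) (q j)))

/-- `u ∈ dom 𝓔`: `u` is continuous on the gasket and has finite energy `lim 𝓔_m(u, u)`.
Functions on the gasket are represented by functions on the plane, of which only the values on the
gasket are used. -/
def MemDomEnergy (q : Fin 3 → Plane) (u : Plane → ℝ) : Prop :=
  ContinuousOn u (gasket q) ∧ ∃ e : ℝ, Tendsto (fun m => graphEnergy q m u u) atTop (𝓝 e)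

/-- `u ∈ dom Δ` and `Δ u = f`: `f` is continuous, `u ∈ dom 𝓔`, and
`𝓔(u, v) = - ∫ f v dμ` for all `v ∈ dom 𝓔` that vanish on `V_0`, where
`𝓔(u, v) = lim 𝓔_m(u, v)`. -/
def HasLaplacian (q : Fin 3 → Plane) (u f : Plane → ℝ) : Prop :=
  ContinuousOn f (gasket q) ∧ MemDomEnergy q u ∧
    ∀ v : Plane → ℝ, MemDomEnergy q v → (∀ x ∈ V q 0, v x = 0) →
      Tendsto (fun m => graphEnergy q m u v) atTop (𝓝 (-∫ y, f y * v y ∂(mu q)))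

/-- `h` is a harmonic function on the gasket: it is continuous, and
`h x = (1/4) ∑_{y ∼_m x} h y` for every `m` and every nonboundary point `x` of `V_m`. -/
def IsHarmonic (q : Fin 3 → Plane) (h : Plane → ℝ) : Prop :=
  ContinuousOn h (gasket q) ∧
    ∀ m, ∀ x ∈ V q m \ V q 0, h x = (1 / 4 : ℝ) * ∑ᶠ y ∈ {y | Adj q m x y}, h y

/-- The vector from the boundary point `F_w (q j)` of the cell `F_w (SG)` to the midpoint of the
other two boundary points. Its norm is the size `ρ` of the cell. -/
def axis (q : Fin 3 → Plane) (w : List (Fin 3)) (j : Fin 3) : Plane :=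
  wordMap q w (midpoint ℝ (q (j + 1)) (q (j + 2))) - wordMap q w (q j)

/-- The part of the cell `C = F_w (SG)` cut off, symmetrically with respect to the axis through the
boundary point `p = F_w (q j)`, by the line at distance `c ρ` from `p` (the side of `p`). -/
def cutCell (q : Fin 3 → Plane) (w : List (Fin 3)) (j : Fin 3) (c : ℝ) : Set Plane :=
  {y ∈ cell q w | inner ℝ (y - wordMap q w (q j)) (axis q w j) ≤ c * ‖axis q w j‖ ^ 2}

/-- `E_i`: the part, cut off at `p_i = F_w (q i)` with parameter `c`, of the neighboring cell
`C_i = F_v (SG)` of `C_w`, that is, of the other cell of the same level that has `p_i` as a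
boundary point. -/
def neighborCut (q : Fin 3 → Plane) (w : List (Fin 3)) (i : Fin 3) (c : ℝ) : Set Plane :=
  {y | ∃ v : List (Fin 3), v.length = w.length ∧ v ≠ w ∧
    ∃ j, wordMap q v (q j) = wordMap q w (q i) ∧ y ∈ cutCell q v j c}

/-- `B(c_0, c_1, c_2) = C_w ∪ E_0 ∪ E_1 ∪ E_2`. -/
def shape (q : Fin 3 → Plane) (w : List (Fin 3)) (c : Fin 3 → ℝ) : Set Plane :=
  cell q w ∪ ⋃ i, neighborCut q w i (c i)

/-- The mean value `M_B(u) = μ(B)⁻¹ ∫_B u dμ`. -/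
def mean (q : Fin 3 → Plane) (B : Set Plane) (u : Plane → ℝ) : ℝ := ⨍ y in B, u y ∂(mu q)

/-- `B` is a `k` level mean value neighborhood of `x`: for some `k`-cell `C_w` that contains `x`
and does not meet `V_0`, `B` is one of the sets `B(c_0, c_1, c_2)` with `0 ≤ c_i ≤ 1`, and
`M_B(h) = h(x)` for all harmonic functions `h`. -/
def IsMeanValueNhd (q : Fin 3 → Plane) (k : ℕ) (x : Plane) (B : Set Plane) : Prop :=
  ∃ w : List (Fin 3), w.length = k ∧ x ∈ cell q w ∧ Disjoint (cell q w) (V q 0) ∧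
    (∃ c : Fin 3 → ℝ, (∀ i, c i ∈ Set.Icc (0 : ℝ) 1) ∧ B = shape q w c) ∧
    ∀ h : Plane → ℝ, IsHarmonic q h → mean q B h = h x

/-- `c_B = M_B(v) - v(x)`, to be used with a function `v` such that `Δ v ≡ 1`. -/
def cConst (q : Fin 3 → Plane) (v : Plane → ℝ) (B : Set Plane) (x : Plane) : ℝ :=
  mean q B v - v x

/-! ### The gasket is the attractor, and the measure is not a junk value -/

lemma summable_coding (q : Fin 3 → Plane) (ω : ℕ → Fin 3) :
    Summable fun n => (1 / 2 : ℝ) ^ (n + 1) • q (ω n) := by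
  refine Summable.of_norm_bounded (g := fun n => (1 / 2 : ℝ) ^ (n + 1) * ∑ i, ‖q i‖) ?_ ?_
  · exact ((summable_nat_add_iff 1).2 summable_geometric_two).mul_right _
  · intro n
    rw [norm_smul, Real.norm_of_nonneg (by positivity)]
    gcongr
    exact Finset.single_le_sum (f := fun i => ‖q i‖) (fun i _ => norm_nonneg _)
      (Finset.mem_univ (ω n))

lemma continuous_coding (q : Fin 3 → Plane) : Continuous (coding q) := by
  unfold coding
  refine continuous_tsum (f := fun n (ω : ℕ → Fin 3) => (1 / 2 : ℝ) ^ (n + 1) • q (ω n))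
    (u := fun n => (1 / 2 : ℝ) ^ (n + 1) * ∑ i, ‖q i‖) ?_ ?_ ?_
  · intro n
    have h1 : Continuous q := continuous_of_discreteTopology
    have h2 : Continuous fun ω : ℕ → Fin 3 => ω n := continuous_apply n
    have h3 : Continuous fun ω : ℕ → Fin 3 => q (ω n) := h1.comp h2
    exact Continuous.smul (M := ℝ) (X := Plane) continuous_const h3
  · exact ((summable_nat_add_iff 1).2 summable_geometric_two).mul_right _
  · intro n ω
    rw [norm_smul, Real.norm_of_nonneg (by positivity)]
    gcongr
    exact Finset.single_le_sum (f := fun i => ‖q i‖) (fun i _ => norm_nonneg _)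
      (Finset.mem_univ (ω n))

lemma measurable_coding (q : Fin 3 → Plane) : Measurable (coding q) :=
  (continuous_coding q).measurable

instance (q : Fin 3 → Plane) : IsProbabilityMeasure (mu q) :=
  Measure.isProbabilityMeasure_map (measurable_coding q).aemeasurable

lemma isCompact_gasket (q : Fin 3 → Plane) : IsCompact (gasket q) :=
  isCompact_range (continuous_coding q)

lemma gasket_nonempty (q : Fin 3 → Plane) : (gasket q).Nonempty := Set.range_nonempty _

/-- The address of `F_i x` is the address of `x`, preceded by `i`. -/
lemma coding_eq (q : Fin 3 → Plane) (ω : ℕ → Fin 3) :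
    coding q ω = F q (ω 0) (coding q fun n => ω (n + 1)) := by
  unfold coding F
  rw [(summable_coding q ω).tsum_eq_zero_add, smul_sub, ← tsum_const_smul'']
  have : ∀ n, (1 / 2 : ℝ) ^ (n + 1 + 1) • q (ω (n + 1))
      = (1 / 2 : ℝ) • (1 / 2 : ℝ) ^ (n + 1) • q (ω (n + 1)) := by
    intro n; rw [smul_smul, ← pow_succ']
  simp only [this]
  module

lemma gasket_eq_iUnion (q : Fin 3 → Plane) : gasket q = ⋃ i, F q i '' gasket q := by
  ext x
  simp only [mem_iUnion, gasket]
  constructor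
  · rintro ⟨ω, rfl⟩
    exact ⟨ω 0, _, ⟨_, rfl⟩, (coding_eq q ω).symm⟩
  · rintro ⟨i, _, ⟨ω, rfl⟩, rfl⟩
    exact ⟨fun n => Nat.casesOn n i ω, coding_eq q _⟩

lemma dist_F (q : Fin 3 → Plane) (i : Fin 3) (x y : Plane) :
    dist (F q i x) (F q i y) = 1 / 2 * dist x y := by
  rw [F, F, dist_add_left, dist_smul₀, dist_sub_right]
  norm_num

/-- If `A ⊆ ⋃ F_i(A)`, `⋃ F_i(B) ⊆ B` with `A`, `B` compact and `B` nonempty, then `A ⊆ B`. -/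
lemma subset_of_invariant (q : Fin 3 → Plane) {A B : Set Plane} (hA : IsCompact A)
    (hB : IsCompact B) (hBn : B.Nonempty) (h1 : A ⊆ ⋃ i, F q i '' A)
    (h2 : ⋃ i, F q i '' B ⊆ B) : A ⊆ B := by
  rcases A.eq_empty_or_nonempty with rfl | hAn
  · exact empty_subset _
  obtain ⟨a, ha, hmax⟩ := hA.exists_isMaxOn hAn (Metric.continuous_infDist_pt B).continuousOn
  obtain ⟨i, a', ha', rfl⟩ : ∃ i, ∃ a' ∈ A, F q i a' = a := by simpa using h1 ha
  obtain ⟨b, hb, hdist⟩ := hB.exists_infDist_eq_dist hBn a'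
  have h3 : Metric.infDist (F q i a') B ≤ dist (F q i a') (F q i b) :=
    Metric.infDist_le_dist_of_mem (h2 (mem_iUnion.2 ⟨i, mem_image_of_mem _ hb⟩))
  rw [dist_F, ← hdist] at h3
  have h4 : Metric.infDist a' B ≤ Metric.infDist (F q i a') B := hmax ha'
  have h5 : Metric.infDist (F q i a') B ≤ 0 := by linarith
  intro x hx
  rw [hB.isClosed.mem_iff_infDist_zero hBn]
  exact le_antisymm ((hmax hx).trans h5) Metric.infDist_nonneg

lemma eq_gasket (q : Fin 3 → Plane) {K : Set Plane} (hK : IsCompact K) (hKn : K.Nonempty)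
    (h : K = ⋃ i, F q i '' K) : K = gasket q :=
  (subset_of_invariant q hK (isCompact_gasket q) (gasket_nonempty q) h.subset
    (gasket_eq_iUnion q).superset).antisymm
    (subset_of_invariant q (isCompact_gasket q) hK hKn (gasket_eq_iUnion q).subset h.superset)

end SG

end

open MeasureTheory Filter Topology Set

noncomputable section

namespace SG

variable {q : Fin 3 → Plane}

/-! Put `U = u - g x • v`, so that `Δ U = g - g x`. By the oscillation condition this is at most `2
c γ^k` in absolute value on every `k`-cell that meets the `k`-cell `C_w` containing `x`. The defect
`M_B(U) - U(x)` equals `M_B(u) - u(x) - g(x) c_B`. So it is enough to show that a Laplacian bounded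
by `ε` near `x` gives a defect of at most `5 ε 5^{-k}` (`abs_mean_sub_le`), and that `c_B ≥ 5^{-k} /
216` (`cConst_lower_bound`). The quotient then differs from `g x` by `O(γ^k)`.

Both bounds come from one exact formula, `mean_sub_eq`. Since `B` reproduces harmonic functions, `u`
may be replaced by its difference with the harmonic function that has the same values at the three
boundary points of `C_w`. On `C_w` this leaves the solution of a Dirichlet problem with zero
boundary values. On a neighboring cell it vanishes at the shared vertex, and the matching condition
`WeakLaplacian.junction` gives the sum of the other two boundary values. The cut is symmetric about
its axis, so only that sum enters the integral of the harmonic part.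

The upper bound then follows from the sup estimate `WeakLaplacian.abs_le_of_vertex_eq_zero`. For the
lower bound every Dirichlet problem has a constant right side, so all its solutions are multiples of
the torsion function `z` (`Δ z = 1`, `z = 0` on `V_0`). This function is self-similar (`torsion_F`),
which gives its integral and linear barriers in terms of harmonic functions. The harmonic
coordinates of `x` are determined by the areas of the cuts (`harmonic_coordinate_eq`), and
positivity becomes a linear inequality.

The differential equation is used only against piecewise harmonic test functions. For these the
graph energies are eventually constant, so the weak equation is an exact finite identity that
rescales under `F_i`. Functions are handled through addresses: `coding` is a quotient map, and it
identifies addresses only at the junctions `F_i q_j = F_j q_i` and their images. -/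

/-! ### Addresses -/

/-- The address `ω`, preceded by the letter `i`. -/
def scons (i : Fin 3) (ω : ℕ → Fin 3) : ℕ → Fin 3 := fun n => Nat.casesOn n i ω

/-- The address `ω` without its first letter. -/
def stail (ω : ℕ → Fin 3) : ℕ → Fin 3 := fun n => ω (n + 1)

@[simp] lemma scons_zero (i : Fin 3) (ω : ℕ → Fin 3) : scons i ω 0 = i := rfl

@[simp] lemma scons_succ (i : Fin 3) (ω : ℕ → Fin 3) (n : ℕ) : scons i ω (n + 1) = ω n := rfl

@[simp] lemma stail_scons (i : Fin 3) (ω : ℕ → Fin 3) : stail (scons i ω) = ω := rfl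

lemma scons_stail (ω : ℕ → Fin 3) : scons (ω 0) (stail ω) = ω := by
  funext n; cases n <;> rfl

lemma continuous_stail : Continuous stail :=
  continuous_pi fun n => continuous_apply (n + 1)

/-- The first letter is a continuous coordinate with values in a discrete space, so continuity can
be checked on the three cylinders it defines. -/
lemma continuous_of_forall_scons {Y : Type*} [TopologicalSpace Y] {Φ : (ℕ → Fin 3) → Y}
    (h : ∀ i, Continuous fun ω => Φ (scons i ω)) : Continuous Φ := by
  have h1 : Continuous fun p : Fin 3 × (ℕ → Fin 3) => Φ (scons p.1 p.2) :=
    continuous_prod_of_discrete_left.2 h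
  have h2 : Continuous fun ω : ℕ → Fin 3 => (ω 0, stail ω) :=
    (continuous_apply 0).prodMk continuous_stail
  have h3 := h1.comp h2
  have : (fun p : Fin 3 × (ℕ → Fin 3) => Φ (scons p.1 p.2)) ∘ (fun ω => (ω 0, stail ω)) = Φ := by
    funext ω; simp [scons_stail]
  rwa [this] at h3

lemma coding_scons (q : Fin 3 → Plane) (i : Fin 3) (ω : ℕ → Fin 3) :
    coding q (scons i ω) = F q i (coding q ω) := coding_eq q _

lemma F_self (q : Fin 3 → Plane) (i : Fin 3) : F q i (q i) = q i := by simp [F]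

lemma F_injective (q : Fin 3 → Plane) (i : Fin 3) : Function.Injective (F q i) := by
  intro x y h
  have := dist_F q i x y
  rw [h, dist_self] at this
  exact dist_eq_zero.1 (by linarith)

lemma coding_const (q : Fin 3 → Plane) (i : Fin 3) : coding q (fun _ => i) = q i := by
  have h : scons i (fun _ => i) = fun _ => i := by funext n; cases n <;> rfl
  have h1 := coding_scons q i (fun _ => i)
  rw [h] at h1
  have h2 := dist_F q i (coding q fun _ => i) (q i)
  rw [← h1, F_self] at h2
  exact dist_eq_zero.1 (by linarith)

lemma coding_mem (q : Fin 3 → Plane) (ω : ℕ → Fin 3) : coding q ω ∈ gasket q := ⟨ω, rfl⟩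

lemma vertex_mem (q : Fin 3 → Plane) (i : Fin 3) : q i ∈ gasket q := ⟨_, coding_const q i⟩

lemma F_mem {i : Fin 3} {y : Plane} (hy : y ∈ gasket q) : F q i y ∈ gasket q := by
  obtain ⟨ω, rfl⟩ := hy
  exact ⟨_, coding_scons q i ω⟩

lemma exists_F_of_mem {y : Plane} (hy : y ∈ gasket q) : ∃ i, ∃ z ∈ gasket q, F q i z = y := by
  rw [gasket_eq_iUnion] at hy
  simpa using hy

lemma wordMap_mem (w : List (Fin 3)) {y : Plane} (hy : y ∈ gasket q) :
    wordMap q w y ∈ gasket q := by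
  induction w with
  | nil => exact hy
  | cons i w ih => exact F_mem ih

lemma wordMap_injective (q : Fin 3 → Plane) (w : List (Fin 3)) :
    Function.Injective (wordMap q w) := by
  induction w with
  | nil => exact Function.injective_id
  | cons i w ih => exact (F_injective q i).comp ih

lemma wordMap_cons (i : Fin 3) (w : List (Fin 3)) (y : Plane) :
    wordMap q (i :: w) y = F q i (wordMap q w y) := rfl

lemma wordMap_append (v w : List (Fin 3)) (y : Plane) :
    wordMap q (v ++ w) y = wordMap q v (wordMap q w y) := by
  induction v with
  | nil => rfl
  | cons i v ih => simp only [List.cons_append, wordMap_cons, ih]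

lemma wordMap_replicate_self (i : Fin 3) (r : ℕ) : wordMap q (List.replicate r i) (q i) = q i := by
  induction r with
  | zero => rfl
  | succ r ih => rw [List.replicate_succ, wordMap_cons, ih, F_self]

lemma continuous_F (q : Fin 3 → Plane) (i : Fin 3) : Continuous (F q i) := by
  unfold F; fun_prop

lemma continuous_wordMap (q : Fin 3 → Plane) (w : List (Fin 3)) : Continuous (wordMap q w) := by
  induction w with
  | nil => exact continuous_id
  | cons i w ih => exact (continuous_F q i).comp ih

lemma measurableEmbedding_F (q : Fin 3 → Plane) (i : Fin 3) : MeasurableEmbedding (F q i) :=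
  (continuous_F q i).measurableEmbedding (F_injective q i)

lemma measurableEmbedding_wordMap (q : Fin 3 → Plane) (w : List (Fin 3)) :
    MeasurableEmbedding (wordMap q w) :=
  (continuous_wordMap q w).measurableEmbedding (wordMap_injective q w)

lemma wordMap_sub (w : List (Fin 3)) (x y : Plane) :
    wordMap q w x - wordMap q w y = ((1 / 2 : ℝ) ^ w.length) • (x - y) := by
  induction w with
  | nil => simp [wordMap]
  | cons i w ih =>
    have : F q i (wordMap q w x) - F q i (wordMap q w y)
        = (1 / 2 : ℝ) • (wordMap q w x - wordMap q w y) := by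
      simp only [F]; module
    rw [wordMap_cons, wordMap_cons, this, ih, smul_smul, List.length_cons, pow_succ']

/-- Restriction of functions on the plane to the gasket, in terms of addresses. -/
lemma continuousOn_gasket_iff {f : Plane → ℝ} :
    ContinuousOn f (gasket q) ↔ Continuous fun ω => f (coding q ω) := by
  constructor
  · intro h
    exact h.comp_continuous (continuous_coding q) (coding_mem q)
  · intro h
    rw [continuousOn_iff_continuous_domRestrict]
    -- A continuous map from a compact space to a Hausdorff space is closed, so the coding map onto
    -- the gasket is a quotient map.
    have hq : IsQuotientMap (Set.rangeFactorization (coding q)) := by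
      have h1 : Continuous (Set.rangeFactorization (coding q)) :=
        (continuous_coding q).subtype_mk _
      exact h1.isClosedMap.isQuotientMap h1 Set.rangeFactorization_surjective
    have : Continuous ((gasket q).domRestrict f ∘ Set.rangeFactorization (coding q)) := h
    exact hq.continuous_iff.2 this

lemma continuousOn_of_comp_F {f : Plane → ℝ} (h : ∀ i, ContinuousOn (f ∘ F q i) (gasket q)) :
    ContinuousOn f (gasket q) := by
  rw [continuousOn_gasket_iff]
  refine continuous_of_forall_scons fun i => ?_
  have := continuousOn_gasket_iff.1 (h i)
  simpa only [coding_scons, Function.comp_def] using this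

lemma continuousOn_comp_wordMap {f : Plane → ℝ} (h : ContinuousOn f (gasket q))
    (w : List (Fin 3)) : ContinuousOn (f ∘ wordMap q w) (gasket q) :=
  h.comp (continuous_wordMap q w).continuousOn fun _ hy => wordMap_mem w hy

lemma continuousOn_comp_F {f : Plane → ℝ} (h : ContinuousOn f (gasket q))
    (i : Fin 3) : ContinuousOn (f ∘ F q i) (gasket q) :=
  h.comp (continuous_F q i).continuousOn fun _ hy => F_mem hy

/-! ### Geometry of the triangle -/

lemma add_one_ne (i : Fin 3) : i + 1 ≠ i := by revert i; decide

lemma add_two_ne (i : Fin 3) : i + 2 ≠ i := by revert i; decide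

lemma add_one_ne_add_two (i : Fin 3) : i + 1 ≠ i + 2 := by revert i; decide

lemma eq_or_eq_add (i j : Fin 3) : j = i ∨ j = i + 1 ∨ j = i + 2 := by revert i j; decide


/-- The midpoint of the side opposite to `q i`, as a vector from `q i`. -/
lemma axis_nil (q : Fin 3 → Plane) (i : Fin 3) :
    axis q [] i = midpoint ℝ (q (i + 1)) (q (i + 2)) - q i := rfl

/-- In an equilateral triangle the median is also an altitude, so the other two vertices project
onto the foot of the axis. The proof uses only that two sides of length `l` have inner product `l ^
2 / 2`. -/
lemma inner_axis (hq : Equilateral q) (i : Fin 3) :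
    0 < ‖axis q [] i‖ ^ 2 ∧ inner ℝ (q (i + 1) - q i) (axis q [] i) = ‖axis q [] i‖ ^ 2 ∧
      inner ℝ (q (i + 2) - q i) (axis q [] i) = ‖axis q [] i‖ ^ 2 := by
  obtain ⟨l, hl, h⟩ := hq
  have e1 : ‖q (i + 1) - q i‖ ^ 2 = l ^ 2 := by
    rw [← dist_eq_norm, h _ _ (add_one_ne i)]
  have e2 : ‖q (i + 2) - q i‖ ^ 2 = l ^ 2 := by
    rw [← dist_eq_norm, h _ _ (add_two_ne i)]
  have e3 : ‖(q (i + 1) - q i) - (q (i + 2) - q i)‖ ^ 2 = l ^ 2 := by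
    rw [sub_sub_sub_cancel_right, ← dist_eq_norm, h _ _ (add_one_ne_add_two i)]
  have ha : axis q [] i = (1 / 2 : ℝ) • ((q (i + 1) - q i) + (q (i + 2) - q i)) := by
    rw [axis_nil, midpoint_eq_smul_add, invOf_eq_inv]; module
  rw [ha]
  generalize q (i + 1) - q i = x at *
  generalize q (i + 2) - q i = y at *
  rw [@norm_sub_sq_real] at e3
  rw [← real_inner_self_eq_norm_sq]
  simp only [inner_smul_left, inner_smul_right, inner_add_left, inner_add_right,
    real_inner_self_eq_norm_sq, real_inner_comm x y, e1, e2]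
  rw [real_inner_comm y x] at *
  simp only [conj_trivial]
  have hl2 : 0 < l ^ 2 := by positivity
  refine ⟨?_, ?_, ?_⟩ <;> nlinarith

/-- The height of `y` over the vertex `q i`, relative to the height of the triangle. -/
def height (q : Fin 3 → Plane) (i : Fin 3) (y : Plane) : ℝ :=
  inner ℝ (y - q i) (axis q [] i) / ‖axis q [] i‖ ^ 2

lemma height_vertex (hq : Equilateral q) (i j : Fin 3) :
    height q i (q j) = if j = i then 0 else 1 := by
  obtain ⟨h0, h1, h2⟩ := inner_axis hq i
  rcases eq_or_eq_add i j with rfl | rfl | rfl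
  · simp [height]
  · rw [height, h1, div_self h0.ne', if_neg (add_one_ne i)]
  · rw [height, h2, div_self h0.ne', if_neg (add_two_ne i)]

/-- `F q j y` is the midpoint of `y` and `q j`, and `height` is affine. Thus heights can be read off
from addresses as binary expansions. -/
lemma height_F (hq : Equilateral q) (i j : Fin 3) (y : Plane) :
    height q i (F q j y) = height q i y / 2 + (if j = i then 0 else 1) / 2 := by
  rw [← height_vertex hq i j]
  have : F q j y - q i = (1 / 2 : ℝ) • ((y - q i) + (q j - q i)) := by simp only [F]; module
  simp only [height, this, inner_smul_left, inner_add_left]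
  simp; ring

lemma continuous_height (q : Fin 3 → Plane) (i : Fin 3) : Continuous (height q i) := by
  unfold height; fun_prop

/-- Extremal principle: a continuous function on the gasket whose values on the three cells of the
next level are bounded below, up to a contraction, by its own values. -/
lemma nonneg_of_forall_F {f : Plane → ℝ} (hf : ContinuousOn f (gasket q)) {t : ℝ} (ht : t < 1)
    (ht0 : 0 ≤ t)
    (h : ∀ i, ∀ y ∈ gasket q, 0 ≤ f (F q i y) ∨ ∃ z ∈ gasket q, t * f z ≤ f (F q i y)) :
    ∀ y ∈ gasket q, 0 ≤ f y := by
  obtain ⟨a, ha, hmin⟩ := (isCompact_gasket q).exists_isMinOn (gasket_nonempty q) hf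
  intro y hy
  refine le_trans ?_ (hmin hy)
  obtain ⟨i, b, hb, rfl⟩ := exists_F_of_mem ha
  rcases h i b hb with h1 | ⟨z, hz, h1⟩
  · exact h1
  · have h2 : f (F q i b) ≤ f z := hmin hz
    nlinarith

lemma height_mem_Icc (hq : Equilateral q) (i : Fin 3) {y : Plane} (hy : y ∈ gasket q) :
    height q i y ∈ Icc (0 : ℝ) 1 := by
  refine ⟨?_, ?_⟩
  · refine nonneg_of_forall_F (continuous_height q i).continuousOn (t := 1 / 2) (by norm_num)
      (by norm_num) (fun j z hz => Or.inr ⟨z, hz, ?_⟩) y hy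
    rw [height_F hq]; split_ifs <;> linarith
  · have := nonneg_of_forall_F (f := fun y => 1 - height q i y)
      (continuous_const.sub (continuous_height q i)).continuousOn (t := 1 / 2) (by norm_num)
      (by norm_num) (fun j z hz => Or.inr ⟨z, hz, ?_⟩) y hy
    · linarith
    · simp only [height_F hq]; split_ifs <;> linarith

/-- Each letter other than `i` adds a positive amount to the height over `q i`, and nothing can
cancel it. Hence a vertex of the triangle has only one address. -/
lemma address_of_height_eq_zero (hq : Equilateral q) (i : Fin 3) {ω : ℕ → Fin 3}
    (h : height q i (coding q ω) = 0) : ω = fun _ => i := by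
  have key : ∀ n (ω : ℕ → Fin 3), height q i (coding q ω) = 0 → ω n = i := by
    intro n
    induction n with
    | zero =>
      intro ω h
      have h1 := (height_mem_Icc hq i (coding_mem q (stail ω))).1
      rw [← scons_stail ω, coding_scons, height_F hq] at h
      by_contra hne
      rw [if_neg hne] at h
      linarith
    | succ n ih =>
      intro ω h
      have h1 := (height_mem_Icc hq i (coding_mem q (stail ω))).1
      rw [← scons_stail ω, coding_scons, height_F hq] at h
      refine ih (stail ω) ?_
      split_ifs at h <;> linarith
  exact funext fun n => key n ω h

lemma address_of_vertex (hq : Equilateral q) {i : Fin 3} {ω : ℕ → Fin 3}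
    (h : coding q ω = q i) : ω = fun _ => i :=
  address_of_height_eq_zero hq i (by rw [h, height_vertex hq, if_pos rfl])

lemma eq_vertex_of_height_eq_zero (hq : Equilateral q) (i : Fin 3) {y : Plane} (hy : y ∈ gasket q)
    (h : height q i y = 0) : y = q i := by
  obtain ⟨ω, rfl⟩ := hy
  rw [address_of_height_eq_zero hq i h, coding_const]

/-- The line at half height over `q i` separates the two cells: the first lies on or below it, the
second on or above. A common point lies on it, so `z` has height zero. -/
lemma F_cross_left (hq : Equilateral q) {i j : Fin 3} (hij : i ≠ j) {y z : Plane}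
    (hy : y ∈ gasket q) (hz : z ∈ gasket q) (h : F q i y = F q j z) : z = q i := by
  have h1 : height q i (F q i y) = height q i (F q j z) := by rw [h]
  rw [height_F hq, height_F hq, if_pos rfl, if_neg hij.symm] at h1
  have h2 := (height_mem_Icc hq i hy).2
  have h3 := (height_mem_Icc hq i hz).1
  exact eq_vertex_of_height_eq_zero hq i hz (by linarith)

/-- Two different cells of level one meet only at a common boundary point. -/
lemma F_cross (hq : Equilateral q) {i j : Fin 3} (hij : i ≠ j) {y z : Plane}
    (hy : y ∈ gasket q) (hz : z ∈ gasket q) (h : F q i y = F q j z) : y = q j ∧ z = q i :=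
  ⟨F_cross_left hq hij.symm hz hy h.symm, F_cross_left hq hij hy hz h⟩

lemma F_vertex_comm (q : Fin 3 → Plane) (i j : Fin 3) : F q i (q j) = F q j (q i) := by
  simp only [F]; module

lemma vertex_injective (hq : Equilateral q) : Function.Injective q := by
  intro i j h
  by_contra hne
  have h1 := height_vertex hq j i
  rw [h, height_vertex hq, if_pos rfl, if_neg hne] at h1
  exact zero_ne_one h1

lemma F_eq_vertex (hq : Equilateral q) {i j : Fin 3} {y : Plane} (hy : y ∈ gasket q)
    (h : F q i y = q j) : i = j ∧ y = q j := by
  by_cases hij : i = j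
  · subst hij
    exact ⟨rfl, F_injective q i (h.trans (F_self q i).symm)⟩
  · rw [← F_self q j] at h
    have := F_cross hq hij hy (vertex_mem q j) h
    exact absurd (vertex_injective hq this.2).symm hij

lemma wordMap_eq_vertex (hq : Equilateral q) {w : List (Fin 3)} {j : Fin 3} {y : Plane}
    (hy : y ∈ gasket q) (h : wordMap q w y = q j) : w = List.replicate w.length j ∧ y = q j := by
  induction w with
  | nil => exact ⟨rfl, h⟩
  | cons i w ih =>
    obtain ⟨rfl, h2⟩ := F_eq_vertex hq (wordMap_mem w hy) h
    obtain ⟨h3, h4⟩ := ih h2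
    refine ⟨?_, h4⟩
    rw [List.length_cons, List.replicate_succ, ← h3]

/-! ### Neighboring cells -/

/-- `b` is the last letter different from `i`. This normal form locates the neighbor at `F_w q_i =
F_s (F_b q_i) = F_s (F_i q_b)`: its word is `s` followed by `i` and `r` letters `b`. The excluded
words are those for which `F_w q_i` is the outer vertex `q i`. -/
lemma exists_eq_append_replicate {w : List (Fin 3)} {i : Fin 3}
    (h : w ≠ List.replicate w.length i) :
    ∃ (s : List (Fin 3)) (b : Fin 3) (r : ℕ), b ≠ i ∧ w = s ++ b :: List.replicate r i := by
  induction w with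
  | nil => simp at h
  | cons l w ih =>
    by_cases hw : w = List.replicate w.length i
    · refine ⟨[], l, w.length, ?_, by rw [← hw]; rfl⟩
      rintro rfl
      rw [List.length_cons, List.replicate_succ, ← hw] at h
      exact h rfl
    · obtain ⟨s, b, r, hb, hs⟩ := ih hw
      exact ⟨l :: s, b, r, hb, by rw [hs]; rfl⟩

lemma wordMap_junction (s : List (Fin 3)) (b i : Fin 3) (r : ℕ) :
    wordMap q (s ++ i :: List.replicate r b) (q b) =
      wordMap q (s ++ b :: List.replicate r i) (q i) := by
  simp only [wordMap_append, wordMap_cons, wordMap_replicate_self, F_vertex_comm q i b]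

/-- Cells whose words part at some letter can meet only at the junction belonging to that letter.
Parting inside `s` would make `F_b q_i` a vertex of the large triangle, which is impossible for `b ≠
i`. So the words part at `b`, and beyond it the word and the vertex are forced. -/
lemma neighbor_unique (hq : Equilateral q) {s : List (Fin 3)} {b i : Fin 3} {r : ℕ} (hb : b ≠ i)
    {v : List (Fin 3)} {j : Fin 3} (hl : v.length = (s ++ b :: List.replicate r i).length)
    (hv : v ≠ s ++ b :: List.replicate r i)
    (h : wordMap q v (q j) = wordMap q (s ++ b :: List.replicate r i) (q i)) :
    v = s ++ i :: List.replicate r b ∧ j = b := by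
  induction s generalizing v with
  | nil =>
    obtain _ | ⟨l, v⟩ := v
    · simp at hl
    simp only [List.nil_append, wordMap_cons, wordMap_replicate_self, List.length_cons,
      List.length_replicate, Nat.add_right_cancel_iff] at h hl hv ⊢
    by_cases hlb : l = b
    · subst hlb
      obtain ⟨h1, -⟩ := wordMap_eq_vertex hq (vertex_mem q j) (F_injective q l h)
      rw [hl] at h1
      exact absurd (by rw [h1]) hv
    · obtain ⟨h1, h2⟩ := F_cross hq hlb (wordMap_mem v (vertex_mem q j)) (vertex_mem q i) h
      obtain ⟨h3, h4⟩ := wordMap_eq_vertex hq (vertex_mem q j) h1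
      rw [hl] at h3
      have h5 := vertex_injective hq h2
      exact ⟨by rw [h3, h5], vertex_injective hq h4⟩
  | cons l s ih =>
    obtain _ | ⟨l', v⟩ := v
    · simp at hl
    simp only [List.cons_append, wordMap_cons, List.length_cons,
      Nat.add_right_cancel_iff] at h hl hv ⊢
    by_cases hll : l' = l
    · subst hll
      obtain ⟨h1, h2⟩ := ih hl (fun h => hv (by rw [h])) (F_injective q l' h)
      exact ⟨by rw [h1], h2⟩
    · obtain ⟨-, h2⟩ := F_cross hq hll (wordMap_mem v (vertex_mem q j))
        (wordMap_mem _ (vertex_mem q i)) h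
      rw [wordMap_append, wordMap_cons, wordMap_replicate_self] at h2
      obtain ⟨-, h3⟩ := wordMap_eq_vertex hq (F_mem (vertex_mem q i)) h2
      obtain ⟨h4, h5⟩ := F_eq_vertex hq (vertex_mem q i) h3
      exact absurd (h4.trans (vertex_injective hq h5).symm) hb

/-- Two different cells of the same level share at most one boundary point. -/
lemma shared_vertex_unique (hq : Equilateral q) {v w : List (Fin 3)} (hl : v.length = w.length)
    (hne : v ≠ w) {i j i' j' : Fin 3} (h : wordMap q v (q j) = wordMap q w (q i))
    (h' : wordMap q v (q j') = wordMap q w (q i')) : i = i' := by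
  induction v generalizing w with
  | nil => exact absurd (List.length_eq_zero_iff.1 hl.symm).symm hne
  | cons l v ih =>
    obtain _ | ⟨l', w⟩ := w
    · simp at hl
    simp only [wordMap_cons, List.length_cons, Nat.add_right_cancel_iff] at h h' hl
    by_cases hll : l = l'
    · subst hll
      exact ih hl (fun h => hne (by rw [h])) (F_injective q l h) (F_injective q l h')
    · have h1 := (F_cross hq hll (wordMap_mem v (vertex_mem q j))
        (wordMap_mem _ (vertex_mem q i)) h).2
      have h2 := (F_cross hq hll (wordMap_mem v (vertex_mem q j'))
        (wordMap_mem _ (vertex_mem q i')) h').2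
      have h3 := (wordMap_eq_vertex hq (vertex_mem q i) h1).2
      have h4 := (wordMap_eq_vertex hq (vertex_mem q i') h2).2
      exact vertex_injective hq (h3.trans h4.symm)

/-! ### Gluing -/

/-- The function on the gasket that is given by `φ i` on the cell `F_i (SG)`. -/
def glue (q : Fin 3 → Plane) (φ : Fin 3 → Plane → ℝ) : Plane → ℝ :=
  Function.extend (coding q) (fun ω => φ (ω 0) (coding q (stail ω))) 0

/-- By `F_cross` the points `F_i q_j = F_j q_i` are the only overlaps of the level one cells, so
agreement there makes the piecewise definition consistent. -/
lemma glue_F (hq : Equilateral q) {φ : Fin 3 → Plane → ℝ} (h : ∀ i j, φ i (q j) = φ j (q i))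
    (i : Fin 3) {y : Plane} (hy : y ∈ gasket q) : glue q φ (F q i y) = φ i y := by
  obtain ⟨ω, rfl⟩ := hy
  have hf : Function.FactorsThrough (fun ω : ℕ → Fin 3 => φ (ω 0) (coding q (stail ω)))
      (coding q) := by
    intro ω ω' hω
    rw [← scons_stail ω, ← scons_stail ω', coding_scons, coding_scons] at hω
    by_cases h0 : ω 0 = ω' 0
    · rw [h0] at hω
      simp only [h0, F_injective q _ hω]
    · obtain ⟨h1, h2⟩ := F_cross hq h0 (coding_mem q _) (coding_mem q _) hω
      simp only [h1, h2, h]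
  rw [← coding_scons, glue, hf.extend_apply]
  simp

/-! ### Harmonic functions in terms of addresses -/

/-- The boundary values on the cell `F_i (SG)` of the harmonic function with boundary values `a`. -/
def step (i : Fin 3) (a : Fin 3 → ℝ) : Fin 3 → ℝ := fun j =>
  -- The 2/5–2/5–1/5 rule: weight 2/5 at the two ends of the edge and 1/5 at the opposite vertex.
  if j = i then a i else (a i + a j + ∑ l, a l) / 5

/-- The boundary values on the cell `F_{ω_1} ∘ ⋯ ∘ F_{ω_n} (SG)` of the harmonic function with
boundary values `a`. -/
def cellValues (a : Fin 3 → ℝ) (ω : ℕ → Fin 3) : ℕ → Fin 3 → ℝ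
  | 0 => a
  | n + 1 => step (ω n) (cellValues a ω n)

/-- The total oscillation of three values. -/
def osc (a : Fin 3 → ℝ) : ℝ := |a 0 - a 1| + |a 1 - a 2| + |a 0 - a 2|

lemma osc_nonneg (a : Fin 3 → ℝ) : 0 ≤ osc a := by unfold osc; positivity

/-- With `x`, `z` the differences along the edges at the retained vertex and `y` the opposite one,
the new differences are `(2x + z)/5`, `(2z + x)/5` and `y/5` up to sign. The factor below 1 yields
convergence along addresses and continuity of harmonic functions. -/
lemma osc_step (i : Fin 3) (a : Fin 3 → ℝ) : osc (step i a) ≤ 3 / 5 * osc a := by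
  unfold osc step
  have key : ∀ x y z : ℝ, |(2 * x + z) / 5| + |(2 * z + x) / 5| + |y / 5| ≤
      3 / 5 * (|x| + |y| + |z|) := by
    intro x y z
    have h1 : |(2 * x + z) / 5| ≤ (2 * |x| + |z|) / 5 := by
      rw [abs_div, abs_of_pos (by norm_num : (0:ℝ) < 5)]
      gcongr
      exact (abs_add_le _ _).trans (by rw [abs_mul, abs_of_pos (by norm_num : (0:ℝ) < 2)])
    have h2 : |(2 * z + x) / 5| ≤ (2 * |z| + |x|) / 5 := by
      rw [abs_div, abs_of_pos (by norm_num : (0:ℝ) < 5)]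
      gcongr
      exact (abs_add_le _ _).trans (by rw [abs_mul, abs_of_pos (by norm_num : (0:ℝ) < 2)])
    have h3 : |y / 5| = |y| / 5 := by rw [abs_div, abs_of_pos (by norm_num : (0:ℝ) < 5)]
    have := abs_nonneg y
    linarith
  fin_cases i <;> simp [Fin.sum_univ_three]
  · have := key (a 0 - a 1) (a 1 - a 2) (a 0 - a 2)
    ring_nf at this ⊢; linarith
  · have := key (a 0 - a 1) (a 0 - a 2) (a 2 - a 1)
    rw [abs_sub_comm (a 2) (a 1)] at this
    rw [abs_sub_comm (a 1)]
    rw [← abs_neg, abs_sub_comm (a 1) (a 2)] at this ⊢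
    ring_nf at this ⊢; linarith
  · have := key (a 0 - a 2) (a 0 - a 1) (a 1 - a 2)
    ring_nf at this ⊢; linarith

lemma osc_cellValues (a : Fin 3 → ℝ) (ω : ℕ → Fin 3) (n : ℕ) :
    osc (cellValues a ω n) ≤ (3 / 5) ^ n * osc a := by
  induction n with
  | zero => simp [cellValues]
  | succ n ih =>
    refine (osc_step _ _).trans ?_
    rw [pow_succ']
    linarith

lemma abs_sub_le_osc (a : Fin 3 → ℝ) (i j : Fin 3) : |a i - a j| ≤ osc a := by
  have h1 := abs_nonneg (a 0 - a 1)
  have h2 := abs_nonneg (a 1 - a 2)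
  have h3 := abs_nonneg (a 0 - a 2)
  unfold osc
  fin_cases i <;> fin_cases j <;> simp <;>
    first | positivity | linarith | (rw [abs_sub_comm]; linarith)

lemma abs_step_sub_le (i j : Fin 3) (a : Fin 3 → ℝ) : |step i a j - a j| ≤ osc a := by
  have h0 := abs_sub_le_osc a i j
  have h : step i a j - a j = if j = i then 0 else
      ((a i - a j) + (a 0 - a j) + (a 1 - a j) + (a 2 - a j)) / 5 := by
    unfold step
    split_ifs with h
    · rw [h, sub_self]
    · rw [Fin.sum_univ_three]; ring
  rw [h]
  split_ifs
  · simpa using osc_nonneg a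
  · have h1 := abs_le.1 (abs_sub_le_osc a i j)
    have h2 := abs_le.1 (abs_sub_le_osc a 0 j)
    have h3 := abs_le.1 (abs_sub_le_osc a 1 j)
    have h4 := abs_le.1 (abs_sub_le_osc a 2 j)
    have := osc_nonneg a
    exact abs_le.2 ⟨by linarith, by linarith⟩

/-- The recursion defining `cellValues` refines at the end of the word. This form peels off the
first letter instead, as self-similarity arguments require. -/
lemma cellValues_scons (a : Fin 3 → ℝ) (i : Fin 3) (ω : ℕ → Fin 3) (n : ℕ) :
    cellValues a (scons i ω) (n + 1) = cellValues (step i a) ω n := by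
  induction n with
  | zero => rfl
  | succ n ih => rw [cellValues, ih]; rfl

lemma continuous_cellValues (a : Fin 3 → ℝ) (n : ℕ) :
    Continuous fun ω => cellValues a ω n := by
  induction n with
  | zero => exact continuous_const
  | succ n ih =>
    have h1 : Continuous fun p : Fin 3 × (Fin 3 → ℝ) => step p.1 p.2 := by
      refine continuous_prod_of_discrete_left.2 fun i => continuous_pi fun j => ?_
      simp only [step]
      split_ifs
      · exact continuous_apply i
      · fun_prop
    have h2 : Continuous fun ω : ℕ → Fin 3 => (ω n, cellValues a ω n) :=
      (continuous_apply n).prodMk ih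
    exact h1.comp h2

/-- The harmonic function with boundary values `a`, as a function of the address. -/
def harm (a : Fin 3 → ℝ) (ω : ℕ → Fin 3) : ℝ :=
  -- The telescoped limit of the values at corner `0`. The choice of corner is immaterial because
  -- the oscillation of the values tends to zero.
  a 0 + ∑' n, (cellValues a ω (n + 1) 0 - cellValues a ω n 0)

lemma norm_cellValues_sub_le (a : Fin 3 → ℝ) (ω : ℕ → Fin 3) (n : ℕ) :
    ‖cellValues a ω (n + 1) 0 - cellValues a ω n 0‖ ≤ (3 / 5) ^ n * osc a :=
  (abs_step_sub_le _ _ _).trans (osc_cellValues a ω n)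

lemma summable_geometric_osc (a : Fin 3 → ℝ) :
    Summable fun n : ℕ => (3 / 5 : ℝ) ^ n * osc a :=
  (summable_geometric_of_lt_one (by norm_num) (by norm_num)).mul_right _

lemma continuous_harm (a : Fin 3 → ℝ) : Continuous (harm a) := by
  refine continuous_const.add (continuous_tsum (u := fun n => (3 / 5) ^ n * osc a) (fun n => ?_)
    (summable_geometric_osc a) fun n ω => norm_cellValues_sub_le a ω n)
  exact ((continuous_apply 0).comp (continuous_cellValues a (n + 1))).sub
    ((continuous_apply 0).comp (continuous_cellValues a n))

lemma tendsto_cellValues (a : Fin 3 → ℝ) (ω : ℕ → Fin 3) (j : Fin 3) :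
    Tendsto (fun n => cellValues a ω n j) atTop (𝓝 (harm a ω)) := by
  have hs : Summable fun n => cellValues a ω (n + 1) 0 - cellValues a ω n 0 :=
    Summable.of_norm_bounded (summable_geometric_osc a) (norm_cellValues_sub_le a ω)
  have h1 : Tendsto (fun n => cellValues a ω n 0) atTop (𝓝 (harm a ω)) := by
    have := hs.hasSum.tendsto_sum_nat.const_add (a 0)
    refine this.congr fun n => ?_
    rw [Finset.sum_range_sub (fun n => cellValues a ω n 0)]
    simp [cellValues]
  have h2 : Tendsto (fun n => cellValues a ω n j - cellValues a ω n 0) atTop (𝓝 0) := by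
    refine squeeze_zero_norm (fun n => (abs_sub_le_osc _ _ _).trans (osc_cellValues a ω n)) ?_
    simpa using (tendsto_pow_atTop_nhds_zero_of_lt_one (r := (3 / 5 : ℝ)) (by norm_num)
      (by norm_num)).mul_const (osc a)
  simpa using h2.add h1

lemma harm_scons (a : Fin 3 → ℝ) (i : Fin 3) (ω : ℕ → Fin 3) :
    harm a (scons i ω) = harm (step i a) ω := by
  refine tendsto_nhds_unique ((tendsto_add_atTop_iff_nat 1).2 (tendsto_cellValues a _ 0)) ?_
  simp only [cellValues_scons]
  exact tendsto_cellValues _ _ _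

lemma harm_const (a : Fin 3 → ℝ) (i : Fin 3) : harm a (fun _ => i) = a i := by
  have : ∀ n, cellValues a (fun _ => i) n i = a i := by
    intro n
    induction n with
    | zero => rfl
    | succ n ih => rw [cellValues, step, if_pos rfl, ih]
  have h := tendsto_cellValues a (fun _ => i) i
  simp only [this] at h
  exact tendsto_nhds_unique h tendsto_const_nhds |>.symm ▸ rfl

lemma step_add (i : Fin 3) (a b : Fin 3 → ℝ) : step i (a + b) = step i a + step i b := by
  funext j
  simp only [step, Pi.add_apply, Finset.sum_add_distrib]
  split_ifs <;> ring

lemma step_smul (i : Fin 3) (t : ℝ) (a : Fin 3 → ℝ) : step i (t • a) = t • step i a := by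
  funext j
  simp only [step, Pi.smul_apply, smul_eq_mul, ← Finset.mul_sum]
  split_ifs <;> ring

lemma harm_add (a b : Fin 3 → ℝ) (ω : ℕ → Fin 3) : harm (a + b) ω = harm a ω + harm b ω := by
  have h : ∀ n, cellValues (a + b) ω n = cellValues a ω n + cellValues b ω n := by
    intro n
    induction n with
    | zero => rfl
    | succ n ih => simp only [cellValues, ih, step_add]
  refine tendsto_nhds_unique (tendsto_cellValues (a + b) ω 0) ?_
  simp only [h]
  exact (tendsto_cellValues a ω 0).add (tendsto_cellValues b ω 0)

lemma harm_smul (t : ℝ) (a : Fin 3 → ℝ) (ω : ℕ → Fin 3) : harm (t • a) ω = t * harm a ω := by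
  have h : ∀ n, cellValues (t • a) ω n = t • cellValues a ω n := by
    intro n
    induction n with
    | zero => rfl
    | succ n ih => simp only [cellValues, ih, step_smul]
  refine tendsto_nhds_unique (tendsto_cellValues (t • a) ω 0) ?_
  simp only [h]
  exact (tendsto_cellValues a ω 0).const_mul t

lemma harm_permute (σ : Equiv.Perm (Fin 3)) (a : Fin 3 → ℝ) (ω : ℕ → Fin 3) :
    harm a (fun n => σ (ω n)) = harm (a ∘ σ) ω := by
  have h : ∀ n j, cellValues a (fun n => σ (ω n)) n (σ j) = cellValues (a ∘ σ) ω n j := by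
    intro n
    induction n with
    | zero => intro j; rfl
    | succ n ih =>
      intro j
      simp only [cellValues, step, EmbeddingLike.apply_eq_iff_eq, ← ih]
      rw [Equiv.sum_comp σ]
  refine tendsto_nhds_unique (tendsto_cellValues a _ (σ 0)) ?_
  simp only [h]
  exact tendsto_cellValues _ _ _

lemma harm_nonneg {a : Fin 3 → ℝ} (ha : ∀ i, 0 ≤ a i) (ω : ℕ → Fin 3) : 0 ≤ harm a ω := by
  have h : ∀ n j, 0 ≤ cellValues a ω n j := by
    intro n
    induction n with
    | zero => exact ha
    | succ n ih =>
      intro j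
      simp only [cellValues, step]
      split_ifs
      · exact ih _
      · have := ih (ω n)
        have := ih j
        have := Finset.sum_nonneg fun (l : Fin 3) (_ : l ∈ Finset.univ) => ih l
        positivity
  exact ge_of_tendsto' (tendsto_cellValues a ω 0) fun n => h n 0

lemma harm_const_values (t : ℝ) (ω : ℕ → Fin 3) : harm (fun _ => t) ω = t := by
  have h : ∀ n, cellValues (fun _ => t) ω n = fun _ => t := by
    intro n
    induction n with
    | zero => rfl
    | succ n ih =>
      simp only [cellValues, ih]
      funext j
      simp only [step, Fin.sum_univ_three]
      split_ifs <;> ring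
  refine tendsto_nhds_unique (tendsto_cellValues _ ω 0) ?_
  simp only [h]
  exact tendsto_const_nhds

lemma harm_cross (a : Fin 3 → ℝ) (i j : Fin 3) :
    harm (step i a) (fun _ => j) = harm (step j a) (fun _ => i) := by
  rw [harm_const, harm_const, step, step]
  split_ifs with h1 h2 h2
  · rw [h1]
  · exact absurd h1.symm h2
  · exact absurd h2.symm h1
  · ring

lemma abs_harm_sub_le (a : Fin 3 → ℝ) (ω ω' : ℕ → Fin 3) : |harm a ω - harm a ω'| ≤ osc a := by
  have hmin : ∃ l, ∀ i, a l ≤ a i := Finite.exists_min a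
  have hmax : ∃ l, ∀ i, a i ≤ a l := Finite.exists_max a
  obtain ⟨l, hl⟩ := hmin
  obtain ⟨m, hm⟩ := hmax
  have lo : ∀ ω, a l ≤ harm a ω := fun ω => by
    have := harm_nonneg (a := a + fun _ => -a l) (fun i => by simpa using hl i) ω
    rw [harm_add, harm_const_values] at this
    linarith
  have hi : ∀ ω, harm a ω ≤ a m := fun ω => by
    have := harm_nonneg (a := (fun _ => a m) + (-1 : ℝ) • a) (fun i => by simpa using hm i) ω
    rw [harm_add, harm_const_values, harm_smul] at this
    linarith
  have h1 := abs_le.1 (abs_sub_le_osc a m l)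
  have := lo ω; have := lo ω'; have := hi ω; have := hi ω'
  exact abs_le.2 ⟨by linarith, by linarith⟩

/-- For two addresses of one point, each common leading letter costs a factor 3/5 in the
oscillation. At the first difference both tails are constant, and the values agree by `harm_cross`,
since the rule for the value at `F_i q_j` is symmetric in `i` and `j`. -/
lemma harm_factors (hq : Equilateral q) (a : Fin 3 → ℝ) :
    Function.FactorsThrough (harm a) (coding q) := by
  have key : ∀ n (a : Fin 3 → ℝ) (ω ω' : ℕ → Fin 3), coding q ω = coding q ω' →
      |harm a ω - harm a ω'| ≤ (3 / 5) ^ n * osc a := by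
    intro n
    induction n with
    | zero => intro a ω ω' _; simpa using abs_harm_sub_le a ω ω'
    | succ n ih =>
      intro a ω ω' h
      rw [← scons_stail ω, ← scons_stail ω', coding_scons, coding_scons] at h
      rw [← scons_stail ω, ← scons_stail ω', harm_scons, harm_scons]
      by_cases h0 : ω 0 = ω' 0
      · rw [h0] at h ⊢
        refine (ih _ _ _ (F_injective q _ h)).trans ?_
        have := osc_step (ω' 0) a
        rw [pow_succ, mul_assoc]
        gcongr
      · obtain ⟨h1, h2⟩ := F_cross hq h0 (coding_mem q _) (coding_mem q _) h
        have e1 : harm (step (ω 0) a) (stail ω) = harm (step (ω 0) a) fun _ => ω' 0 := by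
          have : stail ω = fun _ => ω' 0 := address_of_vertex hq h1
          rw [this]
        have e2 : harm (step (ω' 0) a) (stail ω') = harm (step (ω' 0) a) fun _ => ω 0 := by
          have : stail ω' = fun _ => ω 0 := address_of_vertex hq h2
          rw [this]
        rw [e1, e2, harm_cross, sub_self, abs_zero]
        have := osc_nonneg a
        positivity
  intro ω ω' h
  have h1 : Tendsto (fun n : ℕ => (3 / 5 : ℝ) ^ n * osc a) atTop (𝓝 0) := by
    simpa using (tendsto_pow_atTop_nhds_zero_of_lt_one (r := (3 / 5 : ℝ)) (by norm_num)
      (by norm_num)).mul_const (osc a)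
  have h2 := ge_of_tendsto' h1 fun n => key n a ω ω' h
  exact sub_eq_zero.1 (abs_nonpos_iff.1 h2)

/-! ### Harmonic functions on the gasket -/

/-- The harmonic function on the gasket with boundary values `a`. -/
def hfun (q : Fin 3 → Plane) (a : Fin 3 → ℝ) : Plane → ℝ :=
  Function.extend (coding q) (harm a) 0

lemma hfun_coding (hq : Equilateral q) (a : Fin 3 → ℝ) (ω : ℕ → Fin 3) :
    hfun q a (coding q ω) = harm a ω := (harm_factors hq a).extend_apply _ _

lemma hfun_F (hq : Equilateral q) (a : Fin 3 → ℝ) (i : Fin 3) {y : Plane} (hy : y ∈ gasket q) :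
    hfun q a (F q i y) = hfun q (step i a) y := by
  obtain ⟨ω, rfl⟩ := hy
  rw [← coding_scons, hfun_coding hq, hfun_coding hq, harm_scons]

lemma hfun_vertex (hq : Equilateral q) (a : Fin 3 → ℝ) (i : Fin 3) : hfun q a (q i) = a i := by
  rw [← coding_const q i, hfun_coding hq, harm_const]

lemma continuousOn_hfun (hq : Equilateral q) (a : Fin 3 → ℝ) :
    ContinuousOn (hfun q a) (gasket q) := by
  rw [continuousOn_gasket_iff]
  simp only [hfun_coding hq]
  exact continuous_harm a

lemma hfun_add (hq : Equilateral q) (a b : Fin 3 → ℝ) {y : Plane} (hy : y ∈ gasket q) :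
    hfun q (a + b) y = hfun q a y + hfun q b y := by
  obtain ⟨ω, rfl⟩ := hy
  simp only [hfun_coding hq, harm_add]

lemma hfun_smul (hq : Equilateral q) (t : ℝ) (a : Fin 3 → ℝ) {y : Plane} (hy : y ∈ gasket q) :
    hfun q (t • a) y = t * hfun q a y := by
  obtain ⟨ω, rfl⟩ := hy
  simp only [hfun_coding hq, harm_smul]

lemma hfun_const (hq : Equilateral q) (t : ℝ) {y : Plane} (hy : y ∈ gasket q) :
    hfun q (fun _ => t) y = t := by
  obtain ⟨ω, rfl⟩ := hy
  simp only [hfun_coding hq, harm_const_values]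

lemma hfun_nonneg (hq : Equilateral q) {a : Fin 3 → ℝ} (ha : ∀ i, 0 ≤ a i) {y : Plane}
    (hy : y ∈ gasket q) : 0 ≤ hfun q a y := by
  obtain ⟨ω, rfl⟩ := hy
  rw [hfun_coding hq]
  exact harm_nonneg ha ω

lemma hfun_le (hq : Equilateral q) {a : Fin 3 → ℝ} {t : ℝ} (ha : ∀ i, a i ≤ t) {y : Plane}
    (hy : y ∈ gasket q) : hfun q a y ≤ t := by
  have := hfun_nonneg hq (a := (fun _ => t) + (-1 : ℝ) • a) (fun i => by simpa using ha i) hy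
  rw [hfun_add hq _ _ hy, hfun_const hq _ hy, hfun_smul hq _ _ hy] at this
  linarith

lemma le_hfun (hq : Equilateral q) {a : Fin 3 → ℝ} {t : ℝ} (ha : ∀ i, t ≤ a i) {y : Plane}
    (hy : y ∈ gasket q) : t ≤ hfun q a y := by
  have := hfun_nonneg hq (a := a + fun _ => -t) (fun i => by simpa using ha i) hy
  rw [hfun_add hq _ _ hy, hfun_const hq _ hy] at this
  linarith

lemma step_surjective (i : Fin 3) : Function.Surjective (step i) := by
  intro b
  -- Summing `step i a = b` gives `∑ a = 5/3 ∑ b - 2 b i`; each `a j` is then found from its own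
  -- equation.
  refine ⟨fun j => if j = i then b i else
    5 * b j + b i - 5 / 3 * ∑ l, b l, ?_⟩
  funext j
  simp only [step, Fin.sum_univ_three]
  fin_cases i <;> fin_cases j <;> simp <;> ring

/-- A harmonic function can take arbitrary values at the boundary points of a given cell. -/
lemma exists_hfun_wordMap (hq : Equilateral q) (w : List (Fin 3)) (b : Fin 3 → ℝ) :
    ∃ a, ∀ y ∈ gasket q, hfun q a (wordMap q w y) = hfun q b y := by
  induction w generalizing b with
  | nil => exact ⟨b, fun y _ => rfl⟩
  | cons i w ih =>
    obtain ⟨a, ha⟩ := ih b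
    obtain ⟨a', rfl⟩ := step_surjective i a
    exact ⟨a', fun y hy => by rw [wordMap_cons, hfun_F hq _ _ (wordMap_mem w hy), ha y hy]⟩

/-! ### The self-similar measure -/

lemma letterMeasure_singleton (i : Fin 3) : letterMeasure {i} = 3⁻¹ := by
  rw [letterMeasure, PMF.toMeasure_apply_singleton _ _ (measurableSet_singleton i)]
  simp

lemma letterMeasure_apply (t : Set (Fin 3)) :
    letterMeasure t = ∑ i, 3⁻¹ * t.indicator 1 i := by
  classical
  have : t = ⋃ i ∈ Finset.univ.filter (· ∈ t), {i} := by ext; simp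
  conv_lhs => rw [this]
  rw [measure_biUnion_finset (fun i _ j _ hij => by simpa using hij)
    (fun i _ => measurableSet_singleton i), Finset.sum_filter]
  refine Finset.sum_congr rfl fun i _ => ?_
  by_cases h : i ∈ t <;> simp [h, letterMeasure_singleton]

/-- The law of an address with independent uniformly distributed letters. -/
def addressLaw : Measure (ℕ → Fin 3) := Measure.infinitePi fun _ : ℕ => letterMeasure

instance : IsProbabilityMeasure addressLaw := by unfold addressLaw; infer_instance

lemma mu_eq_map (q : Fin 3 → Plane) : mu q = addressLaw.map (coding q) := rfl

lemma measurable_scons (i : Fin 3) : Measurable (scons i) := by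
  refine measurable_pi_lambda _ fun n => ?_
  cases n with
  | zero => exact measurable_const
  | succ n => exact measurable_pi_apply n

/-- The first letter is uniform and independent of the shifted address. By uniqueness of product
measures it is enough to compare values on boxes. -/
lemma addressLaw_eq_sum : addressLaw = ∑ i, (3⁻¹ : ENNReal) • addressLaw.map (scons i) := by
  symm
  refine Measure.eq_infinitePi _ fun s t _ => ?_
  classical
  -- The set of constrained coordinates is enlarged to an initial segment containing `0`, so that
  -- the first factor splits off and the others shift by one.
  obtain ⟨N, hN⟩ : ∃ N, s ⊆ Finset.range (N + 1) := by
    obtain ⟨N, hN⟩ := s.exists_nat_subset_range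
    exact ⟨N, hN.trans (Finset.range_mono (Nat.le_succ N))⟩
  let t' : ℕ → Set (Fin 3) := fun n => if n ∈ s then t n else univ
  have h1 : Set.pi (s : Set ℕ) t = Set.pi (Finset.range (N + 1) : Set ℕ) t' := by
    ext ω
    simp only [Set.mem_pi, Finset.mem_coe, t']
    constructor
    · intro h n _
      split_ifs with hn
      · exact h n hn
      · trivial
    · intro h n hn
      have := h n (hN hn)
      rwa [if_pos hn] at this
  have h2 : ∏ n ∈ s, letterMeasure (t n) = ∏ n ∈ Finset.range (N + 1), letterMeasure (t' n) := by
    rw [← Finset.prod_subset hN (f := fun n => letterMeasure (t' n))]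
    · exact Finset.prod_congr rfl fun n hn => by simp [t', hn]
    · intro n _ hn
      simp [t', hn]
  have hm : ∀ N, MeasurableSet (Set.pi (Finset.range N : Set ℕ) t') := fun N =>
    MeasurableSet.pi (Finset.countable_toSet _) fun n _ => (Set.toFinite _).measurableSet
  rw [h1, h2, Finset.prod_range_succ', letterMeasure_apply (t' 0), Finset.mul_sum]
  simp only [Measure.coe_finsetSum, Finset.sum_apply, Measure.smul_apply, smul_eq_mul]
  refine Finset.sum_congr rfl fun i _ => ?_
  rw [Measure.map_apply (measurable_scons i) (hm _)]
  have h3 : scons i ⁻¹' Set.pi (Finset.range (N + 1) : Set ℕ) t' =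
      {_ω | i ∈ t' 0} ∩ Set.pi (Finset.range N : Set ℕ) fun n => t' (n + 1) := by
    ext ω
    simp only [mem_preimage, Set.mem_pi, Finset.mem_coe, Finset.mem_range, mem_inter_iff,
      mem_ofPred_eq]
    constructor
    · exact fun h => ⟨h 0 (by omega), fun n hn => h (n + 1) (by omega)⟩
    · rintro ⟨h0, h⟩ n hn
      cases n with
      | zero => exact h0
      | succ n => exact h n (by omega)
  rw [h3]
  by_cases hi : i ∈ t' 0
  · have : {_ω : ℕ → Fin 3 | i ∈ t' 0} = univ := by ext; simp [hi]
    rw [this, univ_inter, addressLaw, Measure.infinitePi_pi _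
      fun n _ => (Set.toFinite _).measurableSet]
    simp [hi, mul_comm]
  · have : {_ω : ℕ → Fin 3 | i ∈ t' 0} = ∅ := by ext; simp [hi]
    rw [this, empty_inter]
    simp [hi]

lemma mu_eq_sum (q : Fin 3 → Plane) : mu q = ∑ i, (3⁻¹ : ENNReal) • (mu q).map (F q i) := by
  have hF : ∀ i, Measurable (F q i) := fun i => (continuous_F q i).measurable
  ext A hA
  have h := congrArg (fun ν => ν (coding q ⁻¹' A)) addressLaw_eq_sum
  simp only [Measure.coe_finsetSum, Finset.sum_apply, Measure.smul_apply, smul_eq_mul] at h ⊢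
  rw [mu_eq_map, Measure.map_apply (measurable_coding q) hA, h]
  refine Finset.sum_congr rfl fun i _ => ?_
  rw [Measure.map_apply (measurable_scons i) (measurable_coding q hA),
    Measure.map_apply (hF i) hA, Measure.map_apply (measurable_coding q) (hF i hA)]
  congr 2
  ext ω
  simp [coding_scons]

lemma mu_apply (q : Fin 3 → Plane) {A : Set Plane} (hA : MeasurableSet A) :
    mu q A = ∑ i, 3⁻¹ * mu q (F q i ⁻¹' A) := by
  conv_lhs => rw [mu_eq_sum q]
  simp only [Measure.coe_finsetSum, Finset.sum_apply, Measure.smul_apply, smul_eq_mul]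
  refine Finset.sum_congr rfl fun i _ => ?_
  rw [Measure.map_apply (continuous_F q i).measurable hA]

lemma measurableSet_gasket (q : Fin 3 → Plane) : MeasurableSet (gasket q) :=
  (isCompact_gasket q).measurableSet

lemma mu_compl_gasket (q : Fin 3 → Plane) : mu q (gasket q)ᶜ = 0 := by
  rw [mu_eq_map, Measure.map_apply (measurable_coding q) (measurableSet_gasket q).compl]
  have : coding q ⁻¹' (gasket q)ᶜ = ∅ := by ext ω; simp [coding_mem]
  rw [this, measure_empty]

lemma ae_mem_gasket (q : Fin 3 → Plane) : ∀ᵐ y ∂mu q, y ∈ gasket q := mu_compl_gasket q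

lemma restrict_gasket (q : Fin 3 → Plane) : (mu q).restrict (gasket q) = mu q :=
  Measure.restrict_eq_self_of_ae_mem (ae_mem_gasket q)

lemma mu_eq_zero_of_inter {A B : Set Plane} (hB : mu q B = 0) (h : A ∩ gasket q ⊆ B) :
    mu q A = 0 := by
  refine measure_mono_null (t := B ∪ (gasket q)ᶜ) ?_ (measure_union_null hB (mu_compl_gasket q))
  intro y hy
  by_cases h' : y ∈ gasket q
  · exact Or.inl (h ⟨hy, h'⟩)
  · exact Or.inr h'

/-- Only `F_i` reaches `q i`, and only from `q i` itself, so the mass of this point equals one third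
of itself. -/
lemma mu_vertex (hq : Equilateral q) (i : Fin 3) : mu q {q i} = 0 := by
  have h := mu_apply q (measurableSet_singleton (q i))
  rw [Finset.sum_eq_single i] at h
  · have h1 : F q i ⁻¹' {q i} = {q i} := by
      ext y
      simp only [mem_preimage, mem_singleton_iff]
      exact ⟨fun h => F_injective q i (h.trans (F_self q i).symm), fun h => h ▸ F_self q i⟩
    rw [h1] at h
    have hfin : mu q {q i} ≠ ⊤ := measure_ne_top _ _
    have h2 := congrArg ENNReal.toReal h
    rw [ENNReal.toReal_mul, ENNReal.toReal_inv] at h2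
    have h3 : (mu q {q i}).toReal = 0 := by
      norm_num at h2
      linarith
    exact ((ENNReal.toReal_eq_zero_iff _).1 h3).resolve_right hfin
  · intro j _ hj
    have : mu q (F q j ⁻¹' {q i}) = 0 :=
      mu_eq_zero_of_inter (measure_empty (μ := mu q))
        fun y hy => absurd (F_eq_vertex hq hy.2 hy.1).1 hj
    rw [this, mul_zero]
  · simp

/-- In the self-similar decomposition the other two maps hit this cell only at the images of a
vertex, which is a null set. -/
lemma restrict_image_F (hq : Equilateral q) (i : Fin 3) {S : Set Plane} (hS : MeasurableSet S)
    (hSg : S ⊆ gasket q) :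
    (mu q).restrict (F q i '' S) = (3⁻¹ : ENNReal) • ((mu q).restrict S).map (F q i) := by
  have hF := measurableEmbedding_F q i
  have hFS : MeasurableSet (F q i '' S) := hF.measurableSet_image.2 hS
  ext A hA
  rw [Measure.restrict_apply hA, mu_apply q (hA.inter hFS), Finset.sum_eq_single i]
  · rw [Measure.smul_apply, smul_eq_mul, hF.map_apply, Measure.restrict_apply (hF.measurable hA),
      preimage_inter, preimage_image_eq _ hF.injective]
  · intro j _ hj
    have : mu q (F q j ⁻¹' (A ∩ F q i '' S)) = 0 := by
      refine mu_eq_zero_of_inter (mu_vertex hq i) ?_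
      rintro y ⟨⟨_, z, hz, hzy⟩, hy⟩
      exact (F_cross hq hj hy (hSg hz) hzy.symm).1
    rw [this, mul_zero]
  · simp

lemma restrict_image_wordMap (hq : Equilateral q) (w : List (Fin 3)) {S : Set Plane}
    (hS : MeasurableSet S) (hSg : S ⊆ gasket q) :
    (mu q).restrict (wordMap q w '' S) =
      (3⁻¹ : ENNReal) ^ w.length • ((mu q).restrict S).map (wordMap q w) := by
  induction w with
  | nil => simp [wordMap]
  | cons i w ih =>
    have h1 : wordMap q (i :: w) '' S = F q i '' (wordMap q w '' S) := by
      rw [← image_comp]; rfl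
    have h2 : MeasurableSet (wordMap q w '' S) :=
      (measurableEmbedding_wordMap q w).measurableSet_image.2 hS
    have h3 : wordMap q w '' S ⊆ gasket q := by
      rintro _ ⟨y, hy, rfl⟩
      exact wordMap_mem w (hSg hy)
    rw [h1, restrict_image_F hq i h2 h3, ih, Measure.map_smul, Measure.map_map
      (continuous_F q i).measurable (continuous_wordMap q w).measurable, smul_smul,
      List.length_cons, pow_succ']
    rfl

lemma setIntegral_image_wordMap (hq : Equilateral q) (w : List (Fin 3)) {S : Set Plane}
    (hS : MeasurableSet S) (hSg : S ⊆ gasket q) (f : Plane → ℝ) :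
    ∫ y in wordMap q w '' S, f y ∂mu q =
      (1 / 3 : ℝ) ^ w.length * ∫ y in S, f (wordMap q w y) ∂mu q := by
  rw [restrict_image_wordMap hq w hS hSg, integral_smul_measure,
    (measurableEmbedding_wordMap q w).integral_map]
  simp

lemma measureReal_image_wordMap (hq : Equilateral q) (w : List (Fin 3)) {S : Set Plane}
    (hS : MeasurableSet S) (hSg : S ⊆ gasket q) :
    (mu q).real (wordMap q w '' S) = (1 / 3 : ℝ) ^ w.length * (mu q).real S := by
  have := setIntegral_image_wordMap hq w hS hSg fun _ => 1
  simpa using this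

lemma mu_image_wordMap_eq_zero (hq : Equilateral q) (w : List (Fin 3)) {S : Set Plane}
    (hS : MeasurableSet S) (hSg : S ⊆ gasket q) (h : mu q S = 0) : mu q (wordMap q w '' S) = 0 := by
  have h1 := measureReal_image_wordMap hq w hS hSg
  rw [measureReal_def (mu q) S, h] at h1
  simp only [ENNReal.toReal_zero, mul_zero, measureReal_def] at h1
  exact ((ENNReal.toReal_eq_zero_iff _).1 h1).resolve_right (measure_ne_top _ _)

lemma isCompact_cell (q : Fin 3 → Plane) (w : List (Fin 3)) : IsCompact (cell q w) :=
  (isCompact_gasket q).image (continuous_wordMap q w)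

lemma cell_subset (q : Fin 3 → Plane) (w : List (Fin 3)) : cell q w ⊆ gasket q := by
  rintro _ ⟨y, hy, rfl⟩
  exact wordMap_mem w hy

lemma mu_cell_inter (hq : Equilateral q) {v w : List (Fin 3)} (hl : v.length = w.length)
    (hne : v ≠ w) : mu q (cell q v ∩ cell q w) = 0 := by
  induction v generalizing w with
  | nil => exact absurd (List.length_eq_zero_iff.1 hl.symm).symm hne
  | cons l v ih =>
    obtain _ | ⟨l', w⟩ := w
    · simp at hl
    simp only [List.length_cons, Nat.add_right_cancel_iff] at hl
    have hc : ∀ l w, cell q (l :: w) = wordMap q [l] '' cell q w := by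
      intro l w
      simp only [cell, ← image_comp]; rfl
    rw [hc, hc]
    by_cases hll : l = l'
    · subst hll
      rw [← image_inter (wordMap_injective q [l])]
      exact mu_image_wordMap_eq_zero hq [l]
        ((isCompact_cell q v).measurableSet.inter (isCompact_cell q w).measurableSet)
        (inter_subset_left.trans (cell_subset q v)) (ih hl fun h => hne (by rw [h]))
    · refine measure_mono_null ?_ (mu_image_wordMap_eq_zero hq [l] (measurableSet_singleton (q l'))
        (by simpa using vertex_mem q l') (mu_vertex hq l'))
      rintro _ ⟨⟨y, hy, rfl⟩, z, hz, hzy⟩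
      refine ⟨y, ?_, rfl⟩
      exact (F_cross hq hll (cell_subset q v hy) (cell_subset q w hz) hzy.symm).1

lemma integrable_of_continuousOn {f : Plane → ℝ} (hf : ContinuousOn f (gasket q)) :
    Integrable f (mu q) := by
  rw [← restrict_gasket q]
  exact hf.integrableOn_compact (isCompact_gasket q)

lemma integral_mu {f : Plane → ℝ} (hf : ContinuousOn f (gasket q)) :
    ∫ y, f y ∂mu q = 1 / 3 * ∑ i, ∫ y, f (F q i y) ∂mu q := by
  have hi : ∀ i, Integrable f ((mu q).map (F q i)) := fun i =>
    (measurableEmbedding_F q i).integrable_map_iff.2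
      (integrable_of_continuousOn (continuousOn_comp_F hf i))
  conv_lhs => rw [mu_eq_sum q]
  rw [integral_finsetSum_measure fun i _ => (hi i).smul_measure (by simp), Finset.mul_sum]
  refine Finset.sum_congr rfl fun i _ => ?_
  rw [integral_smul_measure, (measurableEmbedding_F q i).integral_map]
  simp

lemma integral_congr_gasket {f g : Plane → ℝ} (h : ∀ y ∈ gasket q, f y = g y) :
    ∫ y, f y ∂mu q = ∫ y, g y ∂mu q := by
  refine integral_congr_ae ?_
  filter_upwards [ae_mem_gasket q] with y hy using h y hy

lemma abs_setIntegral_le {f : Plane → ℝ} {t : ℝ} (ht : 0 ≤ t) (h : ∀ y ∈ gasket q, |f y| ≤ t)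
    (S : Set Plane) : |∫ y in S, f y ∂mu q| ≤ t := by
  have h1 : ‖∫ y in S, f y ∂mu q‖ ≤ t * (mu q).real S := by
    refine norm_setIntegral_le_of_norm_le_const_ae (measure_lt_top _ _) ?_
    exact ae_restrict_of_ae (by filter_upwards [ae_mem_gasket q] with y hy using h y hy)
  have h2 : (mu q).real S ≤ 1 := measureReal_le_one
  rw [Real.norm_eq_abs] at h1
  nlinarith

lemma addressLaw_permute (σ : Equiv.Perm (Fin 3)) :
    addressLaw.map (fun ω n => σ (ω n)) = addressLaw := by
  have hσ : letterMeasure.map σ = letterMeasure := by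
    ext t _
    rw [Measure.map_apply (measurable_of_finite _) (Set.toFinite _).measurableSet,
      letterMeasure_apply, letterMeasure_apply,
      ← Equiv.sum_comp σ fun i => 3⁻¹ * t.indicator 1 i]
    rfl
  have := Measure.infinitePi_map_pi (fun _ : ℕ => letterMeasure) (f := fun _ => σ)
    fun _ => measurable_of_finite _
  simp only [hσ] at this
  exact this

/-! ### Graph energies and piecewise harmonic functions -/

lemma graphEnergy_zero (q : Fin 3 → Plane) (u v : Plane → ℝ) :
    graphEnergy q 0 u v = (u (q 0) - u (q 1)) * (v (q 0) - v (q 1)) +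
      (u (q 1) - u (q 2)) * (v (q 1) - v (q 2)) + (u (q 0) - u (q 2)) * (v (q 0) - v (q 2)) := by
  simp only [graphEnergy, pow_zero, one_mul, Finset.univ_unique, Finset.sum_singleton,
    List.ofFn_zero, wordMap, id, Fin.sum_univ_three]
  ring

lemma graphEnergy_succ (q : Fin 3 → Plane) (m : ℕ) (u v : Plane → ℝ) :
    graphEnergy q (m + 1) u v = 5 / 3 * ∑ i, graphEnergy q m (u ∘ F q i) (v ∘ F q i) := by
  simp only [graphEnergy]
  rw [← Equiv.sum_comp (Fin.consEquiv fun _ : Fin (m + 1) => Fin 3), Fintype.sum_prod_type,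
    ← Finset.mul_sum, pow_succ', mul_assoc]
  congr 2
  refine Finset.sum_congr rfl fun i _ => Finset.sum_congr rfl fun w _ => ?_
  have : List.ofFn ((Fin.consEquiv fun _ : Fin (m + 1) => Fin 3) (i, w)) = i :: List.ofFn w := by
    simp [Fin.consEquiv, List.ofFn_succ]
  simp only [this, wordMap_cons, Function.comp_apply]

lemma graphEnergy_congr {u u' v v' : Plane → ℝ} (hu : ∀ y ∈ gasket q, u y = u' y)
    (hv : ∀ y ∈ gasket q, v y = v' y) (m : ℕ) : graphEnergy q m u v = graphEnergy q m u' v' := by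
  have h : ∀ (w : List (Fin 3)) i, wordMap q w (q i) ∈ gasket q :=
    fun w i => wordMap_mem w (vertex_mem q i)
  simp only [graphEnergy, hu _ (h _ _), hv _ (h _ _)]

lemma graphEnergy_comm (q : Fin 3 → Plane) (m : ℕ) (u v : Plane → ℝ) :
    graphEnergy q m u v = graphEnergy q m v u := by
  simp only [graphEnergy, mul_comm (u _ - u _)]

lemma graphEnergy_eq_zero (m : ℕ) {u v : Plane → ℝ} (hv : ∀ y ∈ gasket q, v y = 0) :
    graphEnergy q m u v = 0 := by
  have h : ∀ (w : List (Fin 3)) i, v (wordMap q w (q i)) = 0 :=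
    fun w i => hv _ (wordMap_mem w (vertex_mem q i))
  simp [graphEnergy, h]

lemma graphEnergy_add_left (q : Fin 3 → Plane) (m : ℕ) (u u' v : Plane → ℝ) (t : ℝ) :
    graphEnergy q m (fun y => u y + t * u' y) v
      = graphEnergy q m u v + t * graphEnergy q m u' v := by
  simp only [graphEnergy, Finset.mul_sum, ← Finset.sum_add_distrib]
  refine Finset.sum_congr rfl fun w _ => Finset.sum_congr rfl fun i _ =>
    Finset.sum_congr rfl fun j _ => ?_
  ring

/-- The function `φ` is harmonic on each `m`-cell. -/
def IsSpline (q : Fin 3 → Plane) : ℕ → (Plane → ℝ) → Prop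
  | 0, φ => ∃ a, ∀ y ∈ gasket q, φ y = hfun q a y
  | m + 1, φ => ∀ i, IsSpline q m (φ ∘ F q i)

lemma IsSpline.congr {m : ℕ} {φ ψ : Plane → ℝ} (h : IsSpline q m φ)
    (hψ : ∀ y ∈ gasket q, ψ y = φ y) : IsSpline q m ψ := by
  induction m generalizing φ ψ with
  | zero =>
    obtain ⟨a, ha⟩ := h
    exact ⟨a, fun y hy => (hψ y hy).trans (ha y hy)⟩
  | succ m ih => exact fun i => ih (h i) fun y hy => hψ _ (F_mem hy)

lemma isSpline_hfun (a : Fin 3 → ℝ) : IsSpline q 0 (hfun q a) := ⟨a, fun _ _ => rfl⟩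

lemma isSpline_zero (hq : Equilateral q) (m : ℕ) : IsSpline q m fun _ => 0 := by
  induction m with
  | zero => exact ⟨fun _ => 0, fun y hy => (hfun_const hq 0 hy).symm⟩
  | succ m ih => exact fun i => ih

lemma IsSpline.continuousOn (hq : Equilateral q) {m : ℕ} {φ : Plane → ℝ} (h : IsSpline q m φ) :
    ContinuousOn φ (gasket q) := by
  induction m generalizing φ with
  | zero =>
    obtain ⟨a, ha⟩ := h
    exact (continuousOn_hfun hq a).congr ha
  | succ m ih => exact continuousOn_of_comp_F fun i => ih (h i)

/-- Against a harmonic function the values of `u` at the three midpoints get coefficient zero. The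
renormalization 5/3 makes the coefficients at the vertices agree with those of level zero. -/
lemma graphEnergy_one_hfun (hq : Equilateral q) (u : Plane → ℝ) (a : Fin 3 → ℝ) :
    graphEnergy q 1 u (hfun q a) = graphEnergy q 0 u (hfun q a) := by
  rw [show (1 : ℕ) = 0 + 1 from rfl, graphEnergy_succ]
  simp only [graphEnergy_zero, Function.comp_apply, hfun_F hq _ _ (vertex_mem q _),
    hfun_vertex hq, Fin.sum_univ_three, F_self, step]
  simp only [F_vertex_comm q 1 0, F_vertex_comm q 2 0, F_vertex_comm q 2 1]
  simp
  ring

lemma graphEnergy_hfun (hq : Equilateral q) (m : ℕ) (u : Plane → ℝ) (a : Fin 3 → ℝ) :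
    graphEnergy q m u (hfun q a) = graphEnergy q 0 u (hfun q a) := by
  induction m generalizing u a with
  | zero => rfl
  | succ m ih =>
    rw [← graphEnergy_one_hfun hq, show (1 : ℕ) = 0 + 1 from rfl, graphEnergy_succ,
      graphEnergy_succ]
    congr 1
    refine Finset.sum_congr rfl fun i _ => ?_
    have h : ∀ y ∈ gasket q, (hfun q a ∘ F q i) y = hfun q (step i a) y :=
      fun y hy => hfun_F hq a i hy
    rw [graphEnergy_congr (fun _ _ => rfl) h, graphEnergy_congr (fun _ _ => rfl) h, ih]

/-- Nothing is assumed about `u`. Hence the limit in the weak equation is attained at level `m`, and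
the equation becomes an identity between finitely many values of `u` and one integral. -/
lemma IsSpline.graphEnergy_add (hq : Equilateral q) {m : ℕ} {φ : Plane → ℝ} (h : IsSpline q m φ)
    (n : ℕ) (u : Plane → ℝ) : graphEnergy q (m + n) u φ = graphEnergy q m u φ := by
  induction m generalizing φ u with
  | zero =>
    obtain ⟨a, ha⟩ := h
    rw [zero_add, graphEnergy_congr (fun _ _ => rfl) ha, graphEnergy_congr (fun _ _ => rfl) ha,
      graphEnergy_hfun hq]
  | succ m ih =>
    rw [Nat.add_right_comm, graphEnergy_succ, graphEnergy_succ]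
    simp only [ih (h _)]

lemma IsSpline.tendsto_graphEnergy (hq : Equilateral q) {m : ℕ} {φ : Plane → ℝ}
    (h : IsSpline q m φ) (u : Plane → ℝ) :
    Tendsto (fun n => graphEnergy q n u φ) atTop (𝓝 (graphEnergy q m u φ)) := by
  refine tendsto_atTop_of_eventually_const (i₀ := m) fun n hn => ?_
  obtain ⟨k, rfl⟩ := Nat.exists_eq_add_of_le hn
  exact h.graphEnergy_add hq k u

lemma IsSpline.memDomEnergy (hq : Equilateral q) {m : ℕ} {φ : Plane → ℝ} (h : IsSpline q m φ) :
    MemDomEnergy q φ :=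
  ⟨h.continuousOn hq, _, h.tendsto_graphEnergy hq φ⟩

lemma isSpline_glue (hq : Equilateral q) {m : ℕ} {φ : Fin 3 → Plane → ℝ}
    (h : ∀ i j, φ i (q j) = φ j (q i)) (hφ : ∀ i, IsSpline q m (φ i)) :
    IsSpline q (m + 1) (glue q φ) :=
  fun i => (hφ i).congr fun _ hy => glue_F hq h i hy

/-! ### The weak Laplacian -/

/-- The weak form of `Δ u = g`, with piecewise harmonic test functions. -/
structure WeakLaplacian (q : Fin 3 → Plane) (u g : Plane → ℝ) : Prop where
  cont : ContinuousOn u (gasket q)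
  cont_laplacian : ContinuousOn g (gasket q)
  energy_eq : ∀ (m : ℕ) (φ : Plane → ℝ), IsSpline q m φ → (∀ i, φ (q i) = 0) →
    graphEnergy q m u φ = -∫ y, g y * φ y ∂mu q

lemma mem_V_zero {x : Plane} : x ∈ V q 0 ↔ ∃ i, x = q i := by
  constructor
  · rintro ⟨w, hw, i, rfl⟩
    rw [List.length_eq_zero_iff.1 hw]
    exact ⟨i, rfl⟩
  · rintro ⟨i, rfl⟩
    exact ⟨[], rfl, i, rfl⟩

lemma HasLaplacian.weakLaplacian (hq : Equilateral q) {u g : Plane → ℝ}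
    (h : HasLaplacian q u g) : WeakLaplacian q u g where
  cont := h.2.1.1
  cont_laplacian := h.1
  energy_eq m φ hφ h0 := by
    refine tendsto_nhds_unique (hφ.tendsto_graphEnergy hq u) (h.2.2 φ (hφ.memDomEnergy hq) ?_)
    intro x hx
    obtain ⟨i, rfl⟩ := mem_V_zero.1 hx
    exact h0 i

lemma weakLaplacian_hfun (hq : Equilateral q) (a : Fin 3 → ℝ) :
    WeakLaplacian q (hfun q a) fun _ => 0 where
  cont := continuousOn_hfun hq a
  cont_laplacian := continuousOn_const
  energy_eq m φ _ h0 := by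
    rw [graphEnergy_comm, graphEnergy_hfun hq, graphEnergy_zero]
    simp [h0]

lemma WeakLaplacian.add_mul (hq : Equilateral q) {u u' g g' : Plane → ℝ}
    (h : WeakLaplacian q u g) (h' : WeakLaplacian q u' g') (t : ℝ) :
    WeakLaplacian q (fun y => u y + t * u' y) fun y => g y + t * g' y where
  cont := h.cont.add (continuousOn_const.mul h'.cont)
  cont_laplacian := h.cont_laplacian.add (continuousOn_const.mul h'.cont_laplacian)
  energy_eq m φ hφ h0 := by
    have hc := hφ.continuousOn hq
    rw [graphEnergy_add_left, h.energy_eq m φ hφ h0, h'.energy_eq m φ hφ h0]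
    have : ∀ y, (g y + t * g' y) * φ y = g y * φ y + t * (g' y * φ y) := fun y => by ring
    simp only [this]
    rw [integral_add (f := fun y => g y * φ y) (g := fun y => t * (g' y * φ y))
      (integrable_of_continuousOn (h.cont_laplacian.mul hc))
      ((integrable_of_continuousOn (h'.cont_laplacian.mul hc)).const_mul t), integral_const_mul]
    ring

lemma WeakLaplacian.congr {u u' g g' : Plane → ℝ} (h : WeakLaplacian q u g)
    (hu : ∀ y ∈ gasket q, u' y = u y) (hg : ∀ y ∈ gasket q, g' y = g y) :
    WeakLaplacian q u' g' where
  cont := h.cont.congr hu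
  cont_laplacian := h.cont_laplacian.congr hg
  energy_eq m φ hφ h0 := by
    rw [graphEnergy_congr hu (fun _ _ => rfl), h.energy_eq m φ hφ h0]
    exact congrArg _ (integral_congr_gasket fun y hy => by rw [hg y hy])

/-! ### Localized test functions, rescaling and matching conditions. -/

/-- The function `φ`, transplanted to the cell `F_i (SG)`, and zero on the other cells. -/
def transplant (q : Fin 3 → Plane) (i : Fin 3) (φ : Plane → ℝ) : Plane → ℝ :=
  glue q fun j => if j = i then φ else 0

lemma transplant_F (hq : Equilateral q) {i : Fin 3} {φ : Plane → ℝ}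
    (h : ∀ j, j ≠ i → φ (q j) = 0) (j : Fin 3) {y : Plane} (hy : y ∈ gasket q) :
    transplant q i φ (F q j y) = if j = i then φ y else 0 := by
  rw [transplant, glue_F hq _ j hy]
  · split_ifs <;> rfl
  · intro j k
    by_cases hj : j = i <;> by_cases hk : k = i <;> simp [hj, hk]
    · exact h k hk
    · exact (h j hj).symm

lemma transplant_vertex (hq : Equilateral q) {i : Fin 3} {φ : Plane → ℝ}
    (h : ∀ j, j ≠ i → φ (q j) = 0) (j : Fin 3) :
    transplant q i φ (q j) = if j = i then φ (q i) else 0 := by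
  have := transplant_F hq h j (vertex_mem q j)
  rw [F_self] at this
  rw [this]
  split_ifs with hj
  · rw [hj]
  · rfl

lemma isSpline_transplant (hq : Equilateral q) {m : ℕ} {i : Fin 3} {φ : Plane → ℝ}
    (hφ : IsSpline q m φ) (h : ∀ j, j ≠ i → φ (q j) = 0) :
    IsSpline q (m + 1) (transplant q i φ) := by
  intro j
  by_cases hj : j = i
  · subst hj
    exact hφ.congr fun y hy => by simp [transplant_F hq h j hy]
  · exact (isSpline_zero hq m).congr fun y hy => by simp [transplant_F hq h j hy, hj]

lemma graphEnergy_transplant (hq : Equilateral q) {m : ℕ} {i : Fin 3} {φ : Plane → ℝ}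
    (h : ∀ j, j ≠ i → φ (q j) = 0) (u : Plane → ℝ) :
    graphEnergy q (m + 1) u (transplant q i φ) = 5 / 3 * graphEnergy q m (u ∘ F q i) φ := by
  rw [graphEnergy_succ, Finset.sum_eq_single i]
  · rw [graphEnergy_congr (v := transplant q i φ ∘ F q i) (fun _ _ => rfl) fun y hy =>
      (transplant_F hq h i hy).trans (if_pos rfl)]
  · intro j _ hj
    exact graphEnergy_eq_zero _ fun y hy => (transplant_F hq h j hy).trans (if_neg hj)
  · simp

lemma integral_mul_transplant (hq : Equilateral q) {m : ℕ} {i : Fin 3} {φ g : Plane → ℝ}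
    (hφ : IsSpline q m φ) (h : ∀ j, j ≠ i → φ (q j) = 0) (hg : ContinuousOn g (gasket q)) :
    ∫ y, g y * transplant q i φ y ∂mu q = 1 / 3 * ∫ y, g (F q i y) * φ y ∂mu q := by
  rw [integral_mu (f := fun y => g y * transplant q i φ y)
    (hg.mul ((isSpline_transplant hq hφ h).continuousOn hq)),
    Finset.sum_eq_single i]
  · congr 1
    exact integral_congr_gasket fun y hy => by rw [transplant_F hq h i hy, if_pos rfl]
  · intro j _ hj
    rw [integral_congr_gasket (g := fun _ => 0) fun y hy => by
      rw [transplant_F hq h j hy, if_neg hj, mul_zero]]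
    simp
  · simp

/-- Testing with a transplanted spline scales the energy by 5/3 and the integral by 1/3, whence the
factor 1/5 on the Laplacian. -/
lemma WeakLaplacian.comp_F (hq : Equilateral q) {u g : Plane → ℝ} (h : WeakLaplacian q u g)
    (i : Fin 3) : WeakLaplacian q (u ∘ F q i) fun y => 1 / 5 * g (F q i y) where
  cont := continuousOn_comp_F h.cont i
  cont_laplacian := continuousOn_const.mul (continuousOn_comp_F h.cont_laplacian i)
  energy_eq m φ hφ h0 := by
    have h1 := h.energy_eq (m + 1) (transplant q i φ)
      (isSpline_transplant hq hφ fun j _ => h0 j) fun j => by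
        rw [transplant_vertex hq fun j _ => h0 j, h0, ite_self]
    rw [graphEnergy_transplant hq fun j _ => h0 j,
      integral_mul_transplant hq hφ (fun j _ => h0 j) h.cont_laplacian] at h1
    simp only [mul_assoc]
    rw [integral_const_mul]
    linarith

lemma WeakLaplacian.comp_wordMap (hq : Equilateral q) {u g : Plane → ℝ} (h : WeakLaplacian q u g)
    (w : List (Fin 3)) :
    WeakLaplacian q (u ∘ wordMap q w) fun y => (1 / 5) ^ w.length * g (wordMap q w y) := by
  induction w generalizing u g with
  | nil => simpa [wordMap] using h
  | cons i w ih =>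
    have h1 := ih (h.comp_F hq i)
    refine h1.congr (fun y _ => rfl) fun y _ => ?_
    rw [List.length_cons, pow_succ, wordMap_cons, mul_assoc]

/-- A piecewise harmonic function that is supported on the cell `F_i ∘ ⋯ ∘ F_i (SG)` of level `r`,
and has the value `1` at `q i`. -/
def cornerBump (q : Fin 3 → Plane) (i : Fin 3) : ℕ → Plane → ℝ
  | 0 => hfun q (Pi.single i 1)
  | r + 1 => transplant q i (cornerBump q i r)

lemma cornerBump_spec (hq : Equilateral q) (i : Fin 3) (r : ℕ) :
    IsSpline q r (cornerBump q i r) ∧ ∀ j, cornerBump q i r (q j) = if j = i then 1 else 0 := by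
  induction r with
  | zero =>
    refine ⟨isSpline_hfun _, fun j => ?_⟩
    rw [cornerBump, hfun_vertex hq, Pi.single_apply]
  | succ r ih =>
    have h : ∀ j, j ≠ i → cornerBump q i r (q j) = 0 := fun j hj => by rw [ih.2, if_neg hj]
    refine ⟨isSpline_transplant hq ih.1 h, fun j => ?_⟩
    rw [cornerBump, transplant_vertex hq h, ih.2, if_pos rfl]

lemma graphEnergy_cornerBump (hq : Equilateral q) (i : Fin 3) (r : ℕ) (u : Plane → ℝ) :
    graphEnergy q r u (cornerBump q i r) = (5 / 3) ^ r *
      graphEnergy q 0 (u ∘ wordMap q (List.replicate r i)) (hfun q (Pi.single i 1)) := by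
  induction r generalizing u with
  | zero => simp [cornerBump, wordMap]
  | succ r ih =>
    have h : ∀ j, j ≠ i → cornerBump q i r (q j) = 0 := fun j hj => by
      rw [(cornerBump_spec hq i r).2, if_neg hj]
    rw [cornerBump, graphEnergy_transplant hq h, ih, pow_succ', mul_assoc]
    rfl

lemma integral_mul_cornerBump (hq : Equilateral q) (i : Fin 3) (r : ℕ) {g : Plane → ℝ}
    (hg : ContinuousOn g (gasket q)) :
    ∫ y, g y * cornerBump q i r y ∂mu q = (1 / 3) ^ r *
      ∫ y, g (wordMap q (List.replicate r i) y) * hfun q (Pi.single i 1) y ∂mu q := by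
  induction r generalizing g with
  | zero => simp [cornerBump, wordMap]
  | succ r ih =>
    have h : ∀ j, j ≠ i → cornerBump q i r (q j) = 0 := fun j hj => by
      rw [(cornerBump_spec hq i r).2, if_neg hj]
    rw [cornerBump, integral_mul_transplant hq (cornerBump_spec hq i r).1 h hg,
      ih (g := fun y => g (F q i y)) (continuousOn_comp_F hg i), pow_succ', mul_assoc]
    rfl

lemma graphEnergy_zero_single (hq : Equilateral q) (u : Plane → ℝ) (i : Fin 3) :
    graphEnergy q 0 u (hfun q (Pi.single i 1)) = 3 * u (q i) - ∑ j, u (q j) := by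
  rw [graphEnergy_zero]
  simp only [hfun_vertex hq, Fin.sum_univ_three]
  fin_cases i <;> simp <;> ring

/-- The matching condition at the common boundary point of two cells. -/
lemma WeakLaplacian.junction (hq : Equilateral q) {u g : Plane → ℝ} (h : WeakLaplacian q u g)
    (s : List (Fin 3)) {b i : Fin 3} (hb : b ≠ i) (r : ℕ) {w v : List (Fin 3)}
    (hw : w = s ++ b :: List.replicate r i) (hv : v = s ++ i :: List.replicate r b) :
    (3 * u (wordMap q w (q i)) - ∑ j, u (wordMap q w (q j))) +
      (3 * u (wordMap q v (q b)) - ∑ j, u (wordMap q v (q j))) =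
    -(1 / 5) ^ w.length * ((∫ y, g (wordMap q w y) * hfun q (Pi.single i 1) y ∂mu q) +
      ∫ y, g (wordMap q v y) * hfun q (Pi.single b 1) y ∂mu q) := by
  subst hw hv
  have h1 := h.comp_wordMap hq s
  set U := u ∘ wordMap q s with hU
  set G := fun y => g (wordMap q s y) with hG
  have hGc : ContinuousOn G (gasket q) := continuousOn_comp_wordMap h.cont_laplacian s
  -- The test function is a tent with value 1 at the junction, harmonic on each of the two cells `w`
  -- and `v` and zero elsewhere. It is built inside `F_s (SG)` from one corner bump on each side.
  set φ : Fin 3 → Plane → ℝ := fun l =>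
    if l = b then cornerBump q i r else if l = i then cornerBump q b r else 0 with hφ
  have hφb : φ b = cornerBump q i r := by simp [φ]
  have hφi : φ i = cornerBump q b r := by simp [φ, hb.symm]
  have hφ0 : ∀ l, l ≠ b → l ≠ i → φ l = 0 := fun l h1 h2 => by simp [φ, h1, h2]
  have hval : ∀ l j, φ l (q j) = if (l = b ∧ j = i) ∨ (l = i ∧ j = b) then 1 else 0 := by
    intro l j
    by_cases hl : l = b
    · subst hl
      rw [hφb, (cornerBump_spec hq i r).2]
      simp [hb]
    · by_cases hl' : l = i
      · subst hl'
        rw [hφi, (cornerBump_spec hq b r).2]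
        simp [hl]
      · rw [hφ0 l hl hl']
        simp [hl, hl']
  have hcomp : ∀ l j, φ l (q j) = φ j (q l) := by
    intro l j
    rw [hval, hval]
    congr 1
    simp only [eq_iff_iff]
    tauto
  have hspl : ∀ l, IsSpline q r (φ l) := by
    intro l
    by_cases hl : l = b
    · rw [hl, hφb]; exact (cornerBump_spec hq i r).1
    · by_cases hl' : l = i
      · rw [hl', hφi]; exact (cornerBump_spec hq b r).1
      · rw [hφ0 l hl hl']; exact isSpline_zero hq r
  have hglue : ∀ l, ∀ y ∈ gasket q, glue q φ (F q l y) = φ l y := fun l y hy =>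
    glue_F hq hcomp l hy
  have hS := isSpline_glue hq hcomp hspl
  have h2 := h1.energy_eq (r + 1) (glue q φ) hS fun j => by
    rw [← F_self q j, hglue j _ (vertex_mem q j), hval]
    rw [if_neg]
    rintro (⟨h1, h2⟩ | ⟨h1, h2⟩)
    · exact hb (h1.symm.trans h2)
    · exact hb (h2.symm.trans h1)
  have hsum : ∀ f : Fin 3 → ℝ, (∀ l, l ≠ b → l ≠ i → f l = 0) → ∑ l, f l = f b + f i := by
    intro f hf
    exact Fintype.sum_eq_add b i hb fun l hl => hf l hl.1 hl.2
  simp only [mul_assoc] at h2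
  rw [integral_const_mul] at h2
  change graphEnergy q (r + 1) U (glue q φ) = -(_ * ∫ y, G y * glue q φ y ∂mu q) at h2
  rw [graphEnergy_succ, integral_mu (f := fun y => G y * glue q φ y)
    (hGc.mul (hS.continuousOn hq)), hsum, hsum] at h2
  · rw [graphEnergy_congr (v := glue q φ ∘ F q b) (fun _ _ => rfl) (hglue b),
      graphEnergy_congr (v := glue q φ ∘ F q i) (fun _ _ => rfl) (hglue i),
      integral_congr_gasket (f := fun y => G (F q b y) * glue q φ (F q b y))
        (g := fun y => G (F q b y) * φ b y)
        (fun y hy => by rw [hglue b y hy]),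
      integral_congr_gasket (f := fun y => G (F q i y) * glue q φ (F q i y))
        (g := fun y => G (F q i y) * φ i y)
        (fun y hy => by rw [hglue i y hy]), hφb, hφi,
      graphEnergy_cornerBump hq, graphEnergy_cornerBump hq,
      integral_mul_cornerBump hq i r (g := fun y => G (F q b y)) (continuousOn_comp_F hGc b),
      integral_mul_cornerBump hq b r (g := fun y => G (F q i y)) (continuousOn_comp_F hGc i),
      graphEnergy_zero_single hq, graphEnergy_zero_single hq] at h2
    simp only [wordMap_append, wordMap_cons]
    simp only [hU, hG, Function.comp_apply] at h2
    -- Energy, Laplacian and measure scale by 5/3, 1/5 and 1/3 per level, so all factors combine to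
    -- `5^{-|w|}`.
    have e : (5 / 3 : ℝ) ^ (r + 1) * (1 / 5) ^ (r + 1) = (1 / 3) ^ (r + 1) := by
      rw [← mul_pow]; norm_num
    have hpos : (0 : ℝ) < (5 / 3) ^ (r + 1) := by positivity
    have e2 : (s ++ b :: List.replicate r i).length = s.length + (r + 1) := by simp
    rw [e2, pow_add]
    refine mul_left_cancel₀ hpos.ne' ?_
    generalize (∫ y, g (wordMap q s (F q b (wordMap q (List.replicate r i) y))) *
      hfun q (Pi.single i 1) y ∂mu q) = I at h2 ⊢
    generalize (∫ y, g (wordMap q s (F q i (wordMap q (List.replicate r b) y))) *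
      hfun q (Pi.single b 1) y ∂mu q) = J at h2 ⊢
    have e3 : (5 / 3 : ℝ) ^ (r + 1) * (-((1 / 5) ^ s.length * (1 / 5) ^ (r + 1)) * (I + J)) =
        -((1 / 5) ^ s.length * ((1 / 3) ^ (r + 1) * (I + J))) := by
      rw [← e]; ring
    rw [e3, pow_succ' (1 / 3 : ℝ), pow_succ' (5 / 3 : ℝ)]
    linear_combination h2
  · intro l hl hl'
    rw [integral_congr_gasket (g := fun _ => 0) fun y hy => by
      rw [hglue l y hy, hφ0 l hl hl']; simp]
    simp
  · intro l hl hl'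
    exact graphEnergy_eq_zero _ fun y hy => by
      rw [Function.comp_apply, hglue l y hy, hφ0 l hl hl']; rfl

/-! ### Harmonic functions satisfy the discrete mean value property -/

lemma junction_ne {s : List (Fin 3)} {b i : Fin 3} (hb : b ≠ i) (r : ℕ) :
    s ++ i :: List.replicate r b ≠ s ++ b :: List.replicate r i := by
  intro h
  have := List.append_cancel_left h
  exact hb (List.cons.inj this).1.symm

lemma finsum_mem_ne (f : Fin 3 → ℝ) (i : Fin 3) : ∑ᶠ j ∈ ({i}ᶜ : Set (Fin 3)), f j =
    (∑ j, f j) - f i := by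
  have : ({i}ᶜ : Set (Fin 3)) = ↑(Finset.univ.erase i) := by ext; simp
  rw [this, finsum_mem_coe_finset, Finset.sum_erase_eq_sub (Finset.mem_univ i)]

/-- The four neighbors of an inner vertex are the other corners of the two cells meeting there, and
the mean value property is the matching condition with zero Laplacian. This makes each `hfun`
available in the definition of a mean value neighborhood. -/
lemma isHarmonic_hfun (hq : Equilateral q) (a : Fin 3 → ℝ) : IsHarmonic q (hfun q a) := by
  refine ⟨continuousOn_hfun hq a, ?_⟩
  rintro m x ⟨⟨w, hwm, i, rfl⟩, hx⟩
  have hw0 : w ≠ List.replicate w.length i := by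
    intro h
    rw [h, wordMap_replicate_self] at hx
    exact hx (mem_V_zero.2 ⟨i, rfl⟩)
  obtain ⟨s, b, r, hb, hw⟩ := exists_eq_append_replicate hw0
  obtain ⟨v, hv⟩ : ∃ v, v = s ++ i :: List.replicate r b := ⟨_, rfl⟩
  have hvw : v ≠ w := by rw [hv, hw]; exact junction_ne hb r
  have hlen : v.length = w.length := by rw [hv, hw]; simp
  have hjoin : wordMap q v (q b) = wordMap q w (q i) := by
    rw [hv, hw]; exact wordMap_junction s b i r
  have hinj : ∀ w : List (Fin 3), Function.Injective fun j => wordMap q w (q j) :=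
    fun w => (wordMap_injective q w).comp (vertex_injective hq)
  have hset : {y | Adj q m (wordMap q w (q i)) y} =
      (fun j => wordMap q w (q j)) '' {i}ᶜ ∪ (fun j => wordMap q v (q j)) '' {b}ᶜ := by
    ext y
    constructor
    · rintro ⟨hne, w', hw', i', j', h1, h2⟩
      by_cases hww : w' = w
      · subst hww
        refine Or.inl ⟨j', ?_, h2.symm⟩
        rintro rfl
        exact hne h2.symm
      · obtain ⟨h3, h4⟩ := neighbor_unique hq (s := s) (r := r) hb (v := w') (j := i')
          (by rw [← hw, hw', hwm]) (by rwa [← hw]) (by rw [← hw, h1])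
        refine Or.inr ⟨j', ?_, by rw [hv, ← h3, h2]⟩
        rintro rfl
        rw [← h4] at h2
        exact hne (h1.trans h2.symm)
    · rintro (⟨j, hj, rfl⟩ | ⟨j, hj, rfl⟩)
      · exact ⟨fun h => hj (hinj w h).symm, w, hwm, i, j, rfl, rfl⟩
      · refine ⟨fun h => hj ?_, v, hlen.trans hwm, b, j, hjoin.symm, rfl⟩
        rw [← hjoin] at h
        exact (hinj v h).symm
  have hdisj : Disjoint ((fun j => wordMap q w (q j)) '' {i}ᶜ)
      ((fun j => wordMap q v (q j)) '' {b}ᶜ) := by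
    rw [Set.disjoint_left]
    rintro _ ⟨j, hj, rfl⟩ ⟨l, hl, h⟩
    exact hj (shared_vertex_unique hq hlen hvw hjoin h).symm
  rw [hset, finsum_mem_union hdisj (Set.toFinite _) (Set.toFinite _),
    finsum_mem_image (hinj w).injOn, finsum_mem_image (hinj v).injOn, finsum_mem_ne,
    finsum_mem_ne]
  have h := (weakLaplacian_hfun hq a).junction hq s hb r hw hv
  simp only [zero_mul, integral_zero, add_zero, mul_zero] at h
  rw [hjoin] at h ⊢
  linarith

/-! ### Estimates for the Dirichlet problem -/

lemma abs_integral_mul_single_le (hq : Equilateral q) {g : Plane → ℝ} {ε : ℝ}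
    (hg : ∀ y ∈ gasket q, |g y| ≤ ε) (i : Fin 3) :
    |∫ y, g y * hfun q (Pi.single i 1) y ∂mu q| ≤ ε := by
  have hε : 0 ≤ ε := (abs_nonneg _).trans (hg _ (vertex_mem q 0))
  have := abs_setIntegral_le (q := q) hε (f := fun y => g y * hfun q (Pi.single i 1) y)
    (fun y hy => ?_) univ
  · rwa [Measure.restrict_univ] at this
  · have h0 : 0 ≤ hfun q (Pi.single i 1) y :=
      hfun_nonneg hq (fun j => by rw [Pi.single_apply]; split_ifs <;> norm_num) hy
    have h1 : hfun q (Pi.single i 1) y ≤ 1 :=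
      hfun_le hq (fun j => by rw [Pi.single_apply]; split_ifs <;> norm_num) hy
    rw [abs_mul, abs_of_nonneg h0]
    have := hg y hy
    have := abs_nonneg (g y)
    nlinarith

/-- The matching condition at the boundary points of the cells of level one. -/
lemma WeakLaplacian.midpoint_eq (hq : Equilateral q) {u g : Plane → ℝ} (h : WeakLaplacian q u g) :
    ∃ e : Fin 3 → Fin 3 → ℝ,
      (∀ b i, e b i = 1 / 5 * ((∫ y, g (F q b y) * hfun q (Pi.single i 1) y ∂mu q) +
        ∫ y, g (F q i y) * hfun q (Pi.single b 1) y ∂mu q)) ∧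
      ∀ i j, j ≠ i → u (F q i (q j)) =
        step i (u ∘ q) j - (e i j + (e 0 1 + e 1 2 + e 0 2) / 2) / 5 := by
  refine ⟨_, fun _ _ => rfl, ?_⟩
  set e : Fin 3 → Fin 3 → ℝ := fun b i =>
    1 / 5 * ((∫ y, g (F q b y) * hfun q (Pi.single i 1) y ∂mu q) +
      ∫ y, g (F q i y) * hfun q (Pi.single b 1) y ∂mu q) with he
  have hcomm : ∀ b i, e b i = e i b := fun b i => by simp only [he]; ring
  have key : ∀ b i, b ≠ i → (3 * u (F q b (q i)) - ∑ j, u (F q b (q j))) +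
      (3 * u (F q i (q b)) - ∑ j, u (F q i (q j))) = -e b i := by
    intro b i hb
    have := h.junction hq [] hb 0 (w := [b]) (v := [i]) rfl rfl
    simp only [wordMap, Function.comp_apply, id, List.length_singleton, pow_one] at this
    rw [this]
    simp only [he]; ring
  -- Three linear equations in the three midpoint values; solving them gives the harmonic rule with
  -- a correction linear in `e`.
  have k01 := key 0 1 (by decide)
  have k12 := key 1 2 (by decide)
  have k02 := key 0 2 (by decide)
  simp only [Fin.sum_univ_three, F_self] at k01 k12 k02
  simp only [F_vertex_comm q 1 0, F_vertex_comm q 2 0, F_vertex_comm q 2 1] at k01 k12 k02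
  change ∀ i j, j ≠ i → u (F q i (q j)) =
        step i (u ∘ q) j - (e i j + (e 0 1 + e 1 2 + e 0 2) / 2) / 5
  have c1 := hcomm 1 0
  have c2 := hcomm 2 0
  have c3 := hcomm 2 1
  intro i j hij
  fin_cases i <;> fin_cases j <;> simp [step, Fin.sum_univ_three] at hij ⊢ <;>
    (try simp only [F_vertex_comm q 1 0, F_vertex_comm q 2 0, F_vertex_comm q 2 1]) <;> linarith

/-- Each `e` is at most `2ε/5`, and the correction is at most `(1 + 3/2)/5` times this bound, which
is `ε/5`. -/
lemma WeakLaplacian.abs_sub_step_le (hq : Equilateral q) {u g : Plane → ℝ}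
    (h : WeakLaplacian q u g) {ε : ℝ} (hg : ∀ y ∈ gasket q, |g y| ≤ ε) (i j : Fin 3) :
    |u (F q i (q j)) - step i (u ∘ q) j| ≤ ε / 5 := by
  have hε : 0 ≤ ε := (abs_nonneg _).trans (hg _ (vertex_mem q 0))
  by_cases hij : j = i
  · subst hij
    rw [F_self, step, if_pos rfl]
    simp only [Function.comp_apply, sub_self, abs_zero]
    positivity
  · obtain ⟨e, he, hu⟩ := h.midpoint_eq hq
    have hb : ∀ b i, |e b i| ≤ 2 / 5 * ε := by
      intro b i
      have h1 := abs_integral_mul_single_le hq (g := fun y => g (F q b y))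
        (fun y hy => hg _ (F_mem hy)) i
      have h2 := abs_integral_mul_single_le hq (g := fun y => g (F q i y))
        (fun y hy => hg _ (F_mem hy)) b
      rw [he, abs_mul, abs_of_pos (by norm_num : (0 : ℝ) < 1 / 5)]
      have := abs_add_le (∫ y, g (F q b y) * hfun q (Pi.single i 1) y ∂mu q)
        (∫ y, g (F q i y) * hfun q (Pi.single b 1) y ∂mu q)
      linarith
    rw [hu i j hij]
    have h1 := abs_le.1 (hb i j)
    have h2 := abs_le.1 (hb 0 1)
    have h3 := abs_le.1 (hb 1 2)
    have h4 := abs_le.1 (hb 0 2)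
    exact abs_le.2 ⟨by linarith, by linarith⟩

/-- The difference of `u` and the harmonic function with the same boundary values. -/
def residual (q : Fin 3 → Plane) (u : Plane → ℝ) : Plane → ℝ :=
  fun y => u y + -1 * hfun q (u ∘ q) y

lemma residual_vertex (hq : Equilateral q) (u : Plane → ℝ) (i : Fin 3) :
    residual q u (q i) = 0 := by
  simp [residual, hfun_vertex hq]

lemma WeakLaplacian.residual (hq : Equilateral q) {u g : Plane → ℝ} (h : WeakLaplacian q u g) :
    WeakLaplacian q (residual q u) g :=
  (h.add_mul hq (weakLaplacian_hfun hq (u ∘ q)) (-1)).congr (fun _ _ => rfl) fun y _ => by simp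

/-- The first `n` letters of `ω`, followed by zeros. -/
def truncate (n : ℕ) (ω : ℕ → Fin 3) : ℕ → Fin 3 := fun k => if k < n then ω k else 0

lemma truncate_succ (n : ℕ) (ω : ℕ → Fin 3) :
    truncate (n + 1) ω = scons (ω 0) (truncate n (stail ω)) := by
  funext k
  cases k with
  | zero => simp [truncate]
  | succ k => simp [truncate, stail]

lemma tendsto_truncate (ω : ℕ → Fin 3) : Tendsto (fun n => truncate n ω) atTop (𝓝 ω) := by
  refine tendsto_pi_nhds.2 fun k => ?_
  refine tendsto_atTop_of_eventually_const (i₀ := k + 1) fun n hn => ?_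
  simp only [truncate, if_pos (Nat.lt_of_succ_le hn)]

/-- On a level one cell, `u` is a harmonic function bounded by `ε/5` plus the solution of a
Dirichlet problem with right side at most `ε/5`. The constant 1/4 is the fixed point `t = 1/5 +
t/5`. The induction covers points with eventually zero addresses, and continuity covers the rest. -/
lemma WeakLaplacian.abs_le_of_vertex_eq_zero (hq : Equilateral q) {u g : Plane → ℝ}
    (h : WeakLaplacian q u g) (h0 : ∀ i, u (q i) = 0) {ε : ℝ} (hg : ∀ y ∈ gasket q, |g y| ≤ ε) :
    ∀ y ∈ gasket q, |u y| ≤ ε / 4 := by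
  have key : ∀ n (u g : Plane → ℝ) (ε : ℝ) (ω : ℕ → Fin 3), WeakLaplacian q u g →
      (∀ i, u (q i) = 0) → (∀ y ∈ gasket q, |g y| ≤ ε) →
      |u (coding q (truncate n ω))| ≤ ε / 4 := by
    intro n
    induction n with
    | zero =>
      intro u g ε ω _ h0 hg
      have hε : 0 ≤ ε := (abs_nonneg _).trans (hg _ (vertex_mem q 0))
      have : truncate 0 ω = fun _ => 0 := by funext k; simp [truncate]
      rw [this, coding_const, h0, abs_zero]
      positivity
    | succ n ih =>
      intro u g ε ω h h0 hg
      rw [truncate_succ, coding_scons]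
      set i := ω 0
      set y := coding q (truncate n (stail ω))
      have hy : y ∈ gasket q := coding_mem q _
      have h1 := h.comp_F hq i
      have h2 := ih _ _ (ε / 5) (stail ω) (h1.residual hq) (residual_vertex hq _) fun z hz => by
        rw [abs_mul, abs_of_pos (by norm_num : (0 : ℝ) < 1 / 5)]
        linarith [hg _ (F_mem (i := i) hz)]
      have h3 : ∀ j, |u (F q i (q j))| ≤ ε / 5 := by
        intro j
        have := h.abs_sub_step_le hq hg i j
        have hs : step i (u ∘ q) j = 0 := by
          simp [step, h0]
        rwa [hs, sub_zero] at this
      have h4 := hfun_le hq (a := (u ∘ F q i) ∘ q) (fun j => (abs_le.1 (h3 j)).2) hy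
      have h5 := le_hfun hq (a := (u ∘ F q i) ∘ q) (fun j => (abs_le.1 (h3 j)).1) hy
      change |u (F q i y) + -1 * hfun q ((u ∘ F q i) ∘ q) y| ≤ _ at h2
      have h6 := abs_le.1 h2
      exact abs_le.2 ⟨by linarith, by linarith⟩
  rintro _ ⟨ω, rfl⟩
  have h1 : Tendsto (fun n => |u (coding q (truncate n ω))|) atTop (𝓝 |u (coding q ω)|) :=
    ((continuousOn_gasket_iff.1 h.cont).tendsto ω |>.comp (tendsto_truncate ω)).abs
  exact le_of_tendsto' h1 fun n => key n u g ε ω h h0 hg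

/-! ### Reflections -/

/-- Symmetries of the triangle act on addresses by permuting letters. This preserves the law of the
address and permutes boundary values of harmonic functions, so no isometry of the plane is needed.
-/
lemma setIntegral_hfun_permute (hq : Equilateral q) (σ : Equiv.Perm (Fin 3)) (a : Fin 3 → ℝ)
    {S : Set Plane} (hS : MeasurableSet S)
    (hσ : ∀ ω, coding q (fun n => σ (ω n)) ∈ S ↔ coding q ω ∈ S) :
    ∫ y in S, hfun q (a ∘ σ) y ∂mu q = ∫ y in S, hfun q a y ∂mu q := by
  have hm : Measurable fun (ω : ℕ → Fin 3) n => σ (ω n) :=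
    measurable_pi_lambda _ fun n => (measurable_of_finite σ).comp (measurable_pi_apply n)
  have hS' : MeasurableSet (coding q ⁻¹' S) := measurable_coding q hS
  have h1 : ∀ a, ∫ y in S, hfun q a y ∂mu q = ∫ ω in coding q ⁻¹' S, harm a ω ∂addressLaw := by
    intro a
    have hi := (integrable_of_continuousOn (continuousOn_hfun hq a)).aestronglyMeasurable
    rw [mu_eq_map] at hi ⊢
    rw [setIntegral_map hS hi (measurable_coding q).aemeasurable]
    simp only [hfun_coding hq]
  rw [h1, h1]
  conv_rhs => rw [← addressLaw_permute σ]
  rw [setIntegral_map hS' (continuous_harm a).aestronglyMeasurable hm.aemeasurable]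
  have h2 : (fun (ω : ℕ → Fin 3) n => σ (ω n)) ⁻¹' (coding q ⁻¹' S) = coding q ⁻¹' S := by
    ext ω; exact hσ ω
  rw [h2]
  simp only [harm_permute]

lemma hfun_eq_sum (hq : Equilateral q) (a : Fin 3 → ℝ) {y : Plane} (hy : y ∈ gasket q) :
    hfun q a y = ∑ i, a i * hfun q (Pi.single i 1) y := by
  have : a = a 0 • Pi.single 0 1 + a 1 • Pi.single 1 1 + a 2 • Pi.single 2 1 := by
    funext i; fin_cases i <;> simp
  conv_lhs => rw [this]
  rw [hfun_add hq _ _ hy, hfun_add hq _ _ hy, hfun_smul hq _ _ hy, hfun_smul hq _ _ hy,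
    hfun_smul hq _ _ hy, Fin.sum_univ_three]

lemma setIntegral_hfun (hq : Equilateral q) (a : Fin 3 → ℝ) (S : Set Plane) :
    ∫ y in S, hfun q a y ∂mu q = ∑ i, a i * ∫ y in S, hfun q (Pi.single i 1) y ∂mu q := by
  have h1 : ∀ᵐ y ∂(mu q).restrict S, hfun q a y = ∑ i, a i * hfun q (Pi.single i 1) y :=
    ae_restrict_of_ae (by filter_upwards [ae_mem_gasket q] with y hy using hfun_eq_sum hq a hy)
  rw [integral_congr_ae h1, integral_finsetSum]
  · simp only [integral_const_mul]
  · exact fun i _ => ((integrable_of_continuousOn (continuousOn_hfun hq _)).restrict).const_mul _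

lemma sum_setIntegral_single (hq : Equilateral q) (S : Set Plane) :
    ∑ i, ∫ y in S, hfun q (Pi.single i 1) y ∂mu q = (mu q).real S := by
  have h1 := setIntegral_hfun hq (fun _ => 1) S
  have h2 : ∀ᵐ y ∂(mu q).restrict S, hfun q (fun _ => 1) y = 1 :=
    ae_restrict_of_ae (by filter_upwards [ae_mem_gasket q] with y hy using hfun_const hq 1 hy)
  rw [integral_congr_ae h2] at h1
  simpa using h1.symm

lemma single_comp_swap (i j : Fin 3) :
    (Pi.single i 1 : Fin 3 → ℝ) ∘ Equiv.swap i j = Pi.single j 1 := by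
  funext l
  rw [Function.comp_apply, Pi.single_apply, Pi.single_apply]
  congr 1
  rw [Equiv.swap_apply_eq_iff, Equiv.swap_apply_left]

/-- The three integrals agree by symmetry, and they add up to the total mass 1. -/
lemma integral_hfun_single (hq : Equilateral q) (i : Fin 3) :
    ∫ y, hfun q (Pi.single i 1) y ∂mu q = 1 / 3 := by
  have h : ∀ i j, ∫ y, hfun q (Pi.single j 1) y ∂mu q = ∫ y, hfun q (Pi.single i 1) y ∂mu q := by
    intro i j
    have := setIntegral_hfun_permute hq (Equiv.swap i j) (Pi.single i 1) MeasurableSet.univ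
      (by simp)
    simpa only [single_comp_swap, Measure.restrict_univ] using this
  have h1 := sum_setIntegral_single hq univ
  simp only [Measure.restrict_univ, probReal_univ] at h1
  rw [Finset.sum_congr rfl fun j _ => h i j] at h1
  simp at h1
  linarith

/-- The part of the gasket below relative height `c` over the vertex `q j`. -/
def cut (q : Fin 3 → Plane) (j : Fin 3) (c : ℝ) : Set Plane := {y ∈ gasket q | height q j y ≤ c}

lemma measurableSet_cut (q : Fin 3 → Plane) (j : Fin 3) (c : ℝ) : MeasurableSet (cut q j c) :=
  (measurableSet_gasket q).inter ((continuous_height q j).measurable measurableSet_Iic)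

lemma cut_subset (q : Fin 3 → Plane) (j : Fin 3) (c : ℝ) : cut q j c ⊆ gasket q := fun _ h => h.1

/-- The height over `q j` depends only on which letters equal `j`, so the reflection fixing `j`
preserves the cuts. -/
lemma height_coding_permute (hq : Equilateral q) (j : Fin 3) (σ : Equiv.Perm (Fin 3))
    (hσ : σ j = j) (ω : ℕ → Fin 3) :
    height q j (coding q fun n => σ (ω n)) = height q j (coding q ω) := by
  have key : ∀ n (ω : ℕ → Fin 3),
      |height q j (coding q fun n => σ (ω n)) - height q j (coding q ω)| ≤ (1 / 2) ^ n := by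
    intro n
    induction n with
    | zero =>
      intro ω
      have h1 := height_mem_Icc hq j (coding_mem q fun n => σ (ω n))
      have h2 := height_mem_Icc hq j (coding_mem q ω)
      rw [pow_zero]
      exact abs_le.2 ⟨by linarith [h1.1, h2.2], by linarith [h1.2, h2.1]⟩
    | succ n ih =>
      intro ω
      have h1 : (fun n => σ (ω n)) = scons (σ (ω 0)) fun n => σ (stail ω n) := by
        funext n; cases n <;> rfl
      have h2 : σ (ω 0) = j ↔ ω 0 = j := by
        constructor
        · intro h; exact σ.injective (h.trans hσ.symm)
        · intro h; rw [h, hσ]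
      have h3 := ih (stail ω)
      rw [h1]
      conv_lhs => rw [← scons_stail ω]
      rw [coding_scons, coding_scons, height_F hq, height_F hq]
      simp only [stail_scons, scons_zero, h2]
      rw [add_sub_add_right_eq_sub, ← sub_div, abs_div, pow_succ]
      norm_num at h3 ⊢
      linarith
  have h := ge_of_tendsto' (tendsto_pow_atTop_nhds_zero_of_lt_one (r := (1 / 2 : ℝ))
    (by norm_num) (by norm_num)) fun n => key n ω
  exact sub_eq_zero.1 (abs_nonpos_iff.1 h)

/-- Only the symmetric part of a harmonic function contributes to its integral over a cut. -/
lemma setIntegral_cut_hfun (hq : Equilateral q) (a : Fin 3 → ℝ) (j : Fin 3) (c : ℝ) :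
    ∫ y in cut q j c, hfun q a y ∂mu q =
      a j * (∫ y in cut q j c, hfun q (Pi.single j 1) y ∂mu q) + ((∑ i, a i) - a j) / 2 *
        ((mu q).real (cut q j c) - ∫ y in cut q j c, hfun q (Pi.single j 1) y ∂mu q) := by
  have hσ : Equiv.swap (j + 1) (j + 2) j = j :=
    Equiv.swap_apply_of_ne_of_ne (add_one_ne j).symm (add_two_ne j).symm
  have h1 := setIntegral_hfun_permute hq (Equiv.swap (j + 1) (j + 2)) (Pi.single (j + 1) 1)
    (measurableSet_cut q j c) (fun ω => by
      simp only [cut, mem_sep_iff, height_coding_permute hq j _ hσ, coding_mem, true_and])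
  rw [single_comp_swap] at h1
  have h2 := sum_setIntegral_single hq (cut q j c)
  have hsum : ∀ f : Fin 3 → ℝ, ∑ i, f i = f j + f (j + 1) + f (j + 2) := by
    intro f
    rw [Fin.sum_univ_three]
    fin_cases j <;> simp <;> ring
  rw [hsum] at h2
  rw [setIntegral_hfun hq a, hsum, hsum, h1, ← h2, h1]
  ring

/-! ### The solution of `Δ z = 1` with vanishing boundary values -/

/-- Uniqueness for the Dirichlet problem: the sup estimate with `ε = 0`, applied to `Z - t z`. -/
lemma WeakLaplacian.eq_mul_of_const (hq : Equilateral q) {z Z : Plane → ℝ} {t : ℝ}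
    (hz : WeakLaplacian q z fun _ => 1) (hz0 : ∀ i, z (q i) = 0)
    (hZ : WeakLaplacian q Z fun _ => t) (hZ0 : ∀ i, Z (q i) = 0) {y : Plane} (hy : y ∈ gasket q) :
    Z y = t * z y := by
  have h := (hZ.add_mul hq hz (-t)).abs_le_of_vertex_eq_zero hq (ε := 0)
    (fun i => by simp [hz0, hZ0]) (fun y _ => by simp) y hy
  rw [zero_div, abs_nonpos_iff] at h
  linarith

lemma step_single_self (i : Fin 3) :
    step i (Pi.single i 1) = (fun _ => 2 / 5) + (3 / 5 : ℝ) • Pi.single i 1 := by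
  funext j
  simp only [step, Pi.add_apply, Pi.smul_apply, Pi.single_apply]
  split_ifs <;> simp <;> norm_num

lemma hfun_single_F_self (hq : Equilateral q) (i : Fin 3) {y : Plane} (hy : y ∈ gasket q) :
    hfun q (Pi.single i 1) (F q i y) = 2 / 5 + 3 / 5 * hfun q (Pi.single i 1) y := by
  rw [hfun_F hq _ _ hy, step_single_self, hfun_add hq _ _ hy, hfun_const hq _ hy,
    hfun_smul hq _ _ hy]

lemma hfun_single_mem_Icc (hq : Equilateral q) (i : Fin 3) {y : Plane} (hy : y ∈ gasket q) :
    hfun q (Pi.single i 1) y ∈ Icc (0 : ℝ) 1 :=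
  ⟨hfun_nonneg hq (fun j => by rw [Pi.single_apply]; split_ifs <;> norm_num) hy,
    hfun_le hq (fun j => by rw [Pi.single_apply]; split_ifs <;> norm_num) hy⟩

section Torsion

variable {z : Plane → ℝ}

/-- `z ∘ F_i` has Laplacian 1/5, so it is `z / 5` plus a harmonic function with value 0 at `q i` and
`-1/15` at the other vertices. Indeed each `e` is `1/5 · 2/3 = 2/15`, and the correction is
`(2/15)(5/2)/5 = 1/15`. -/
lemma torsion_F (hq : Equilateral q) (hz : WeakLaplacian q z fun _ => 1)
    (hz0 : ∀ i, z (q i) = 0) (i : Fin 3) {y : Plane} (hy : y ∈ gasket q) :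
    z (F q i y) = -(1 / 15) + 1 / 15 * hfun q (Pi.single i 1) y + 1 / 5 * z y := by
  have h1 := (hz.comp_F hq i).residual hq
  have h2 := hz.eq_mul_of_const hq hz0 h1 (residual_vertex hq _) hy
  obtain ⟨e, he, hv⟩ := hz.midpoint_eq hq
  simp only [one_mul, integral_hfun_single hq] at he
  have h3 : (z ∘ F q i) ∘ q = (fun _ => -(1 / 15)) + (1 / 15 : ℝ) • Pi.single i 1 := by
    funext j
    simp only [Function.comp_apply, Pi.add_apply, Pi.smul_apply, Pi.single_apply]
    by_cases hj : j = i
    · rw [hj, F_self, hz0]; simp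
    · rw [hv i j hj, if_neg hj, he, he, he, he]
      simp [step, hj, hz0]
      norm_num
  simp only [residual, h3, Function.comp_apply] at h2
  rw [hfun_add hq _ _ hy, hfun_const hq _ hy, hfun_smul hq _ _ hy] at h2
  linarith

lemma torsion_nonpos (hq : Equilateral q) (hz : WeakLaplacian q z fun _ => 1)
    (hz0 : ∀ i, z (q i) = 0) {y : Plane} (hy : y ∈ gasket q) : z y ≤ 0 := by
  have := nonneg_of_forall_F (f := fun y => -z y) hz.cont.neg (t := 1 / 5) (by norm_num)
    (by norm_num) (fun i y hy => Or.inr ⟨y, hy, ?_⟩) y hy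
  · linarith
  · rw [torsion_F hq hz hz0 i hy]
    have := (hfun_single_mem_Icc hq i hy).2
    linarith

/-- The bound is the fixed point of `t = -1/15 + t/5`. -/
lemma le_torsion (hq : Equilateral q) (hz : WeakLaplacian q z fun _ => 1)
    (hz0 : ∀ i, z (q i) = 0) {y : Plane} (hy : y ∈ gasket q) : -(1 / 12) ≤ z y := by
  have := nonneg_of_forall_F (f := fun y => z y + 1 / 12) (hz.cont.add continuousOn_const)
    (t := 1 / 5) (by norm_num) (by norm_num) (fun i y hy => Or.inr ⟨y, hy, ?_⟩) y hy
  · linarith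
  · rw [torsion_F hq hz hz0 i hy]
    have := (hfun_single_mem_Icc hq i hy).1
    linarith

lemma integral_torsion (hq : Equilateral q) (hz : WeakLaplacian q z fun _ => 1)
    (hz0 : ∀ i, z (q i) = 0) : ∫ y, z y ∂mu q = -(1 / 18) := by
  have h1 : ∀ i, ∫ y, z (F q i y) ∂mu q = -(2 / 45) + 1 / 5 * ∫ y, z y ∂mu q := by
    intro i
    rw [integral_congr_gasket fun y hy => torsion_F hq hz hz0 i hy]
    have hi := integrable_of_continuousOn (continuousOn_hfun hq (Pi.single i 1))
    have hz' := integrable_of_continuousOn hz.cont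
    rw [integral_add (f := fun y => -(1 / 15) + 1 / 15 * hfun q (Pi.single i 1) y)
      ((integrable_const _).add (hi.const_mul _)) (hz'.const_mul _),
      integral_add (integrable_const _) (hi.const_mul _), integral_const_mul, integral_const_mul,
      integral_hfun_single hq]
    simp
    ring
  have h2 := integral_mu hz.cont
  simp only [h1] at h2
  simp at h2
  linarith

/-- A lower barrier for the torsion function at the boundary point `q j`. -/
lemma torsion_barrier (hq : Equilateral q) (hz : WeakLaplacian q z fun _ => 1)
    (hz0 : ∀ i, z (q i) = 0) (j : Fin 3) {y : Plane} (hy : y ∈ gasket q) :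
    -(1 / 6) * (1 - hfun q (Pi.single j 1) y) ≤ z y := by
  have hc := continuousOn_hfun hq (Pi.single j 1)
  have := nonneg_of_forall_F (q := q)
    (f := fun y => 1 / 6 * (1 - hfun q (Pi.single j 1) y) + z y)
    ((continuousOn_const.mul (continuousOn_const.sub hc)).add hz.cont)
    (t := 1 / 5) (by norm_num) (by norm_num) (fun i y hy => ?_) y hy
  · linarith
  · by_cases hij : i = j
    · subst hij
      -- On the cell at `q j` the constant 1/6 makes the difference exactly self-similar with ratio
      -- 1/5.
      refine Or.inr ⟨y, hy, le_of_eq ?_⟩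
      rw [torsion_F hq hz hz0 i hy, hfun_single_F_self hq i hy]
      ring
    -- Away from `q j` the crude bound `-1/12` suffices: the harmonic part is at least `-1/15`, and
    -- `1/6 - 1/15 - 1/60 - 1/15 = 1/60`.
    · refine Or.inl ?_
      rw [torsion_F hq hz hz0 i hy, hfun_F hq _ _ hy]
      have h1 := le_torsion hq hz hz0 hy
      have h2 := le_hfun hq (t := 1 / 30 - 1 / 10) (a := (-(1 / 6) : ℝ) • step i (Pi.single j 1) +
        (1 / 15 : ℝ) • Pi.single i 1) (fun l => by
          simp only [step, Pi.add_apply, Pi.smul_apply, Pi.single_apply, smul_eq_mul,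
            Finset.sum_ite_eq', Finset.mem_univ, if_true, if_neg hij]
          by_cases hl : l = i
          · rw [if_pos hl, if_pos hl]; norm_num
          · rw [if_neg hl, if_neg hl]
            split_ifs <;> norm_num) hy
      rw [hfun_add hq _ _ hy, hfun_smul hq _ _ hy, hfun_smul hq _ _ hy] at h2
      linarith

/-- An upper barrier on the cell at `q i`. There `1 - h ∘ F_i = 3/5 (1 - h)` for `h = hfun q
(Pi.single i 1)`, so the harmonic part `-(1/15)(1 - h)` of `torsion_F` is `-(1/9)(1 - h ∘ F_i)`, and
`z ≤ 0` disposes of the rest. -/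
lemma torsion_F_le (hq : Equilateral q) (hz : WeakLaplacian q z fun _ => 1)
    (hz0 : ∀ i, z (q i) = 0) (i : Fin 3) {y : Plane} (hy : y ∈ gasket q) :
    z (F q i y) ≤ -(1 / 9) * (1 - hfun q (Pi.single i 1) (F q i y)) := by
  rw [torsion_F hq hz hz0 i hy, hfun_single_F_self hq i hy]
  have := torsion_nonpos hq hz hz0 hy
  linarith

end Torsion

/-! ### The neighborhoods -/

lemma cutCell_eq (hq : Equilateral q) (v : List (Fin 3)) (j : Fin 3) (c : ℝ) :
    cutCell q v j c = wordMap q v '' cut q j c := by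
  have hax : axis q v j = ((1 / 2 : ℝ) ^ v.length) • axis q [] j := by
    rw [axis, wordMap_sub]; rfl
  have h0 := (inner_axis hq j).1
  have key : ∀ y, inner ℝ (wordMap q v y - wordMap q v (q j)) (axis q v j) ≤
      c * ‖axis q v j‖ ^ 2 ↔ height q j y ≤ c := by
    intro y
    rw [hax, wordMap_sub, height, div_le_iff₀ h0, norm_smul, inner_smul_left, inner_smul_right,
      mul_pow, Real.norm_of_nonneg (by positivity)]
    simp only [conj_trivial]
    have hp : (0 : ℝ) < ((1 / 2 : ℝ) ^ v.length) ^ 2 := by positivity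
    rw [← mul_assoc, ← sq, mul_left_comm c]
    exact mul_le_mul_iff_right₀ hp
  ext x
  constructor
  · rintro ⟨⟨y, hy, rfl⟩, h⟩
    exact ⟨y, ⟨hy, (key y).1 h⟩, rfl⟩
  · rintro ⟨y, ⟨hy, h⟩, rfl⟩
    exact ⟨⟨y, hy, rfl⟩, (key y).2 h⟩

/-- `v` is the neighbor of the cell `w` at the boundary point with index `i`, which has the index
`j` in `v`. -/
structure IsNeighbor (q : Fin 3 → Plane) (w : List (Fin 3)) (i : Fin 3) (v : List (Fin 3))
    (j : Fin 3) : Prop where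
  length_eq : v.length = w.length
  ne : v ≠ w
  vertex_eq : wordMap q v (q j) = wordMap q w (q i)
  unique : ∀ v' j', v'.length = w.length → v' ≠ w → wordMap q v' (q j') = wordMap q w (q i) →
    v' = v ∧ j' = j
  junction : ∀ u g, WeakLaplacian q u g →
    (3 * u (wordMap q w (q i)) - ∑ l, u (wordMap q w (q l))) +
      (3 * u (wordMap q v (q j)) - ∑ l, u (wordMap q v (q l))) =
    -(1 / 5) ^ w.length * ((∫ y, g (wordMap q w y) * hfun q (Pi.single i 1) y ∂mu q) +
      ∫ y, g (wordMap q v y) * hfun q (Pi.single j 1) y ∂mu q)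

/-- Since the cell avoids `V_0`, its word is not constantly `i`, so `F_w q_i` is a genuine junction.
-/
lemma exists_isNeighbor (hq : Equilateral q) {w : List (Fin 3)}
    (hw : Disjoint (cell q w) (V q 0)) (i : Fin 3) : ∃ v j, IsNeighbor q w i v j := by
  have hw0 : w ≠ List.replicate w.length i := by
    intro h
    refine Set.disjoint_left.1 hw ⟨q i, vertex_mem q i, rfl⟩ (mem_V_zero.2 ⟨i, ?_⟩)
    rw [h, wordMap_replicate_self]
  obtain ⟨s, b, r, hb, hs⟩ := exists_eq_append_replicate hw0
  refine ⟨s ++ i :: List.replicate r b, b, ?_, ?_, ?_, ?_, ?_⟩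
  · rw [hs]; simp
  · rw [hs]; exact junction_ne hb r
  · rw [hs]; exact wordMap_junction s b i r
  · intro v' j' h1 h2 h3
    rw [hs] at h1 h2 h3
    exact neighbor_unique hq hb h1 h2 h3
  · intro u g h
    exact h.junction hq s hb r hs rfl

lemma neighborCut_eq (hq : Equilateral q) {w v : List (Fin 3)} {i j : Fin 3}
    (h : IsNeighbor q w i v j) (c : ℝ) : neighborCut q w i c = wordMap q v '' cut q j c := by
  rw [← cutCell_eq hq]
  ext y
  constructor
  · rintro ⟨v', h1, h2, j', h3, h4⟩
    obtain ⟨rfl, rfl⟩ := h.unique v' j' h1 h2 h3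
    exact h4
  · exact fun hy => ⟨v, h.length_eq, h.ne, j, h.vertex_eq, hy⟩

/-- The pieces lie in four different cells of one level, which overlap in null sets. The three
neighbors differ from one another because two cells share at most one boundary point. -/
lemma setIntegral_shape (hq : Equilateral q) {w : List (Fin 3)} {v : Fin 3 → List (Fin 3)}
    {j : Fin 3 → Fin 3} (h : ∀ i, IsNeighbor q w i (v i) (j i)) (c : Fin 3 → ℝ) {f : Plane → ℝ}
    (hf : ContinuousOn f (gasket q)) :
    ∫ y in shape q w c, f y ∂mu q = (1 / 3) ^ w.length * ((∫ y, f (wordMap q w y) ∂mu q) +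
      ∑ i, ∫ y in cut q (j i) (c i), f (wordMap q (v i) y) ∂mu q) := by
  have hsub : ∀ i, neighborCut q w i (c i) ⊆ cell q (v i) := fun i => by
    rw [neighborCut_eq hq (h i)]; exact image_mono (cut_subset q _ _)
  have hmeas : ∀ i, MeasurableSet (neighborCut q w i (c i)) := fun i => by
    rw [neighborCut_eq hq (h i)]
    exact (measurableEmbedding_wordMap q _).measurableSet_image.2 (measurableSet_cut q _ _)
  have hvne : ∀ i i', i ≠ i' → v i ≠ v i' := by
    intro i i' hii hv
    have h1 := (h i).vertex_eq
    have h2 := (h i').vertex_eq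
    rw [hv] at h1
    exact hii (shared_vertex_unique hq (h i').length_eq (h i').ne h1 h2)
  have hd1 : AEDisjoint (mu q) (cell q w) (⋃ i, neighborCut q w i (c i)) := by
    refine AEDisjoint.iUnion_right_iff.2 fun i => ?_
    refine measure_mono_null (inter_subset_inter_right _ (hsub i)) ?_
    exact mu_cell_inter hq (h i).length_eq.symm (h i).ne.symm
  have hd2 : Pairwise (Function.onFun (AEDisjoint (mu q)) fun i => neighborCut q w i (c i)) := by
    intro i i' hii
    refine measure_mono_null (inter_subset_inter (hsub i) (hsub i')) ?_
    exact mu_cell_inter hq ((h i).length_eq.trans (h i').length_eq.symm) (hvne i i' hii)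
  have hi := integrable_of_continuousOn hf
  rw [shape, setIntegral_union₀ hd1 (MeasurableSet.iUnion hmeas).nullMeasurableSet
    hi.integrableOn hi.integrableOn,
    integral_iUnion_ae (fun i => (hmeas i).nullMeasurableSet) hd2 hi.integrableOn, tsum_fintype,
    cell, setIntegral_image_wordMap hq w (measurableSet_gasket q) subset_rfl, restrict_gasket,
    mul_add, Finset.mul_sum]
  congr 1
  refine Finset.sum_congr rfl fun i _ => ?_
  rw [neighborCut_eq hq (h i), setIntegral_image_wordMap hq _ (measurableSet_cut q _ _)
    (cut_subset q _ _), (h i).length_eq]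

lemma measureReal_shape (hq : Equilateral q) {w : List (Fin 3)} {v : Fin 3 → List (Fin 3)}
    {j : Fin 3 → Fin 3} (h : ∀ i, IsNeighbor q w i (v i) (j i)) (c : Fin 3 → ℝ) :
    (mu q).real (shape q w c) =
      (1 / 3) ^ w.length * (1 + ∑ i, (mu q).real (cut q (j i) (c i))) := by
  have := setIntegral_shape hq h c (f := fun _ => 1) continuousOn_const
  simpa using this

lemma mean_shape (hq : Equilateral q) {w : List (Fin 3)} {v : Fin 3 → List (Fin 3)}
    {j : Fin 3 → Fin 3} (h : ∀ i, IsNeighbor q w i (v i) (j i)) (c : Fin 3 → ℝ) {f : Plane → ℝ}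
    (hf : ContinuousOn f (gasket q)) :
    mean q (shape q w c) f * (1 + ∑ i, (mu q).real (cut q (j i) (c i))) =
      (∫ y, f (wordMap q w y) ∂mu q) +
        ∑ i, ∫ y in cut q (j i) (c i), f (wordMap q (v i) y) ∂mu q := by
  have hM : 0 < 1 + ∑ i, (mu q).real (cut q (j i) (c i)) := by positivity
  have h3 : (0 : ℝ) < (1 / 3) ^ w.length := by positivity
  rw [mean, setAverage_eq, measureReal_shape hq h, setIntegral_shape hq h c hf, smul_eq_mul]
  field_simp

lemma mean_add_mul {f g : Plane → ℝ} (hf : ContinuousOn f (gasket q))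
    (hg : ContinuousOn g (gasket q)) (t : ℝ) (B : Set Plane) :
    mean q B (fun y => f y + t * g y) = mean q B f + t * mean q B g := by
  simp only [mean, setAverage_eq, smul_eq_mul]
  rw [integral_add (integrable_of_continuousOn hf).restrict
    ((integrable_of_continuousOn hg).restrict.const_mul t), integral_const_mul]
  ring

lemma exists_hfun_comp_wordMap (hq : Equilateral q) (w : List (Fin 3)) (a : Fin 3 → ℝ) :
    ∃ b, ∀ y ∈ gasket q, hfun q a (wordMap q w y) = hfun q b y := by
  induction w generalizing a with
  | nil => exact ⟨a, fun y _ => rfl⟩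
  | cons i w ih =>
    obtain ⟨b, hb⟩ := ih (step i a)
    exact ⟨b, fun y hy => by rw [wordMap_cons, hfun_F hq _ _ (wordMap_mem w hy), hb y hy]⟩

lemma cut_integral_bounds (hq : Equilateral q) (j : Fin 3) (c : ℝ) :
    0 ≤ ∫ y in cut q j c, hfun q (Pi.single j 1) y ∂mu q ∧
      ∫ y in cut q j c, hfun q (Pi.single j 1) y ∂mu q ≤ (mu q).real (cut q j c) := by
  have hi := (integrable_of_continuousOn (continuousOn_hfun hq (Pi.single j 1))).integrableOn
    (s := cut q j c)
  constructor
  · exact setIntegral_nonneg (measurableSet_cut q j c) fun y hy =>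
      (hfun_single_mem_Icc hq j hy.1).1
  · have := setIntegral_mono_on hi (integrable_const (1 : ℝ)).integrableOn
      (measurableSet_cut q j c) fun y hy => (hfun_single_mem_Icc hq j hy.1).2
    simpa using this

/-! ### The defect of the mean value property: exact formula and bounds. -/

/-- The defect of the mean value property, after subtraction of the harmonic function that agrees
with `u` at the boundary points of the central cell. -/
lemma mean_sub_eq (hq : Equilateral q) {w : List (Fin 3)} {v : Fin 3 → List (Fin 3)}
    {j : Fin 3 → Fin 3} (h : ∀ i, IsNeighbor q w i (v i) (j i)) (c : Fin 3 → ℝ) {ξ : Plane}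
    (hB : ∀ f, IsHarmonic q f → mean q (shape q w c) f = f (wordMap q w ξ))
    {u g : Plane → ℝ} (hu : WeakLaplacian q u g) :
    ∃ (Z : Plane → ℝ) (W : Fin 3 → Plane → ℝ),
      WeakLaplacian q Z (fun y => (1 / 5) ^ w.length * g (wordMap q w y)) ∧
      (∀ i, Z (q i) = 0) ∧
      (∀ l, WeakLaplacian q (W l) fun y => (1 / 5) ^ w.length * g (wordMap q (v l) y)) ∧
      (∀ l i, W l (q i) = 0) ∧
      (mean q (shape q w c) u - u (wordMap q w ξ)) *
          (1 + ∑ i, (mu q).real (cut q (j i) (c i))) =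
        (∫ y, Z y ∂mu q) + (∑ i, (1 / 2 * ((1 / 5) ^ w.length *
          ((∫ y, g (wordMap q w y) * hfun q (Pi.single i 1) y ∂mu q) +
            ∫ y, g (wordMap q (v i) y) * hfun q (Pi.single (j i) 1) y ∂mu q)) *
          ((mu q).real (cut q (j i) (c i)) -
            ∫ y in cut q (j i) (c i), hfun q (Pi.single (j i) 1) y ∂mu q) +
          ∫ y in cut q (j i) (c i), W i y ∂mu q)) -
        Z ξ * (1 + ∑ i, (mu q).real (cut q (j i) (c i))) := by
  obtain ⟨a, ha⟩ := exists_hfun_wordMap hq w ((u ∘ wordMap q w) ∘ q)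
  set Y : Plane → ℝ := fun y => u y + -1 * hfun q a y with hYdef
  have hY : WeakLaplacian q Y g :=
    (hu.add_mul hq (weakLaplacian_hfun hq a) (-1)).congr (fun _ _ => rfl) fun y _ => by simp
  have hYw : ∀ i, Y (wordMap q w (q i)) = 0 := fun i => by
    simp [hYdef, ha _ (vertex_mem q i), hfun_vertex hq]
  have hYv := fun l => hY.comp_wordMap hq (v l)
  refine ⟨Y ∘ wordMap q w, fun l => residual q (Y ∘ wordMap q (v l)), hY.comp_wordMap hq w, hYw,
    fun l => ?_, fun l i => residual_vertex hq _ i, ?_⟩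
  · have := (hYv l).residual hq
    rwa [(h l).length_eq] at this
  have hmean : mean q (shape q w c) u - u (wordMap q w ξ) =
      mean q (shape q w c) Y - Y (wordMap q w ξ) := by
    rw [hYdef, mean_add_mul hu.cont (continuousOn_hfun hq a), hB _ (isHarmonic_hfun hq a)]
    ring
  rw [hmean, sub_mul, mean_shape hq h c hY.cont]
  have hcut : ∀ i, ∫ y in cut q (j i) (c i), Y (wordMap q (v i) y) ∂mu q =
      1 / 2 * ((1 / 5) ^ w.length *
          ((∫ y, g (wordMap q w y) * hfun q (Pi.single i 1) y ∂mu q) +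
            ∫ y, g (wordMap q (v i) y) * hfun q (Pi.single (j i) 1) y ∂mu q)) *
          ((mu q).real (cut q (j i) (c i)) -
            ∫ y in cut q (j i) (c i), hfun q (Pi.single (j i) 1) y ∂mu q) +
          ∫ y in cut q (j i) (c i), residual q (Y ∘ wordMap q (v i)) y ∂mu q := by
    intro i
    have h1 : ∀ y, Y (wordMap q (v i) y) = hfun q ((Y ∘ wordMap q (v i)) ∘ q) y +
        residual q (Y ∘ wordMap q (v i)) y := fun y => by
      simp only [residual, Function.comp_apply]; ring
    -- `Y` vanishes at all corners of the central cell, including the shared vertex, so the matching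
    -- condition reduces to the sum of the two remaining corner values on the neighbor.
    have h2 := (h i).junction Y g hY
    rw [(h i).vertex_eq] at h2
    simp only [hYw, Finset.sum_const_zero] at h2
    simp only [h1]
    rw [integral_add (integrable_of_continuousOn (continuousOn_hfun hq _)).restrict
      (integrable_of_continuousOn ((hYv i).residual hq).cont).restrict, setIntegral_cut_hfun hq]
    have h3 : ((Y ∘ wordMap q (v i)) ∘ q) (j i) = 0 := by
      simp only [Function.comp_apply, (h i).vertex_eq, hYw]
    rw [h3]
    simp only [Function.comp_apply]
    have h4 : ∑ l, Y (wordMap q (v i) (q l)) = (1 / 5) ^ w.length *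
          ((∫ y, g (wordMap q w y) * hfun q (Pi.single i 1) y ∂mu q) +
            ∫ y, g (wordMap q (v i) y) * hfun q (Pi.single (j i) 1) y ∂mu q) := by
      linarith
    rw [h4]
    ring
  simp only [hcut, Function.comp_apply]

/-- The harmonic coordinates of a point, in terms of a mean value neighborhood. -/
lemma harmonic_coordinate_eq (hq : Equilateral q) {w : List (Fin 3)} {v : Fin 3 → List (Fin 3)}
    {j : Fin 3 → Fin 3} (h : ∀ i, IsNeighbor q w i (v i) (j i)) (c : Fin 3 → ℝ) {ξ : Plane}
    (hξ : ξ ∈ gasket q)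
    (hB : ∀ f, IsHarmonic q f → mean q (shape q w c) f = f (wordMap q w ξ)) (i : Fin 3) :
    hfun q (Pi.single i 1) ξ * (1 + ∑ l, (mu q).real (cut q (j l) (c l))) =
      1 / 3 + ∑ l, (if l = i then 2 * (mu q).real (cut q (j l) (c l)) -
        ∫ y in cut q (j l) (c l), hfun q (Pi.single (j l) 1) y ∂mu q else
        -(1 / 2) * ((mu q).real (cut q (j l) (c l)) -
          ∫ y in cut q (j l) (c l), hfun q (Pi.single (j l) 1) y ∂mu q)) := by
  obtain ⟨a, ha⟩ := exists_hfun_wordMap hq w (Pi.single i 1)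
  have h1 := mean_shape hq h c (continuousOn_hfun hq a)
  rw [hB _ (isHarmonic_hfun hq a), ha _ hξ, integral_congr_gasket ha,
    integral_hfun_single hq] at h1
  rw [h1]
  congr 1
  refine Finset.sum_congr rfl fun l _ => ?_
  obtain ⟨b, hb⟩ := exists_hfun_comp_wordMap hq (v l) a
  have h2 : ∫ y in cut q (j l) (c l), hfun q a (wordMap q (v l) y) ∂mu q =
      ∫ y in cut q (j l) (c l), hfun q b y ∂mu q :=
    setIntegral_congr_fun (measurableSet_cut q _ _) fun y hy => hb y hy.1
  have h3 := (h l).junction _ _ (weakLaplacian_hfun hq a)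
  have h4 : b (j l) = if l = i then 1 else 0 := by
    rw [← hfun_vertex hq b, ← hb _ (vertex_mem q _), (h l).vertex_eq, ha _ (vertex_mem q _),
      hfun_vertex hq, Pi.single_apply]
  rw [(h l).vertex_eq] at h3
  simp only [ha _ (vertex_mem q _), hb _ (vertex_mem q _), hfun_vertex hq, zero_mul,
    integral_zero, add_zero, mul_zero, Finset.mem_univ, if_true,
    Pi.single_apply, Finset.sum_ite_eq'] at h3
  rw [h2, setIntegral_cut_hfun hq, h4]
  split_ifs at h3 ⊢ with hl
  -- With zero Laplacian the matching condition forces the corner values on the neighbor to sum to 5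
  -- if the shared value is 1, and to -1 if it is 0.
  · rw [show ∑ l, b l = 5 by linarith]; ring
  · rw [show ∑ l, b l = -1 by linarith]; ring

/-- By the exact formula `5^k c_B M = -1/18 + ∑ ((m_l - p_l)/3 + s_l) - z(ξ) M`. Here `M` is 1 plus
the sum of the cut masses `m_l`, and `p_l` and `s_l` are the integrals over the cuts of the harmonic
coordinate at the shared vertex and of `z`. The lower barrier for `z` bounds the `s_l`, the upper
barrier bounds `z(ξ)`, and `M ≤ 4` turns the resulting 1/54 into 1/216. -/
lemma cConst_lower_bound (hq : Equilateral q) {k : ℕ} {x : Plane} {B : Set Plane}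
    (hB : IsMeanValueNhd q k x B) {v : Plane → ℝ} (hv : WeakLaplacian q v fun _ => 1) :
    (1 / 5) ^ k / 216 ≤ cConst q v B x := by
  obtain ⟨w, rfl, ⟨ξ, hξ, rfl⟩, hw, ⟨c, -, rfl⟩, hmean⟩ := hB
  choose n j hn using exists_isNeighbor hq hw
  obtain ⟨Z, W, hZ, hZ0, hW, hW0, heq⟩ := mean_sub_eq hq hn c hmean hv
  -- The torsion function is obtained from `v` itself, so no existence theorem for the Dirichlet
  -- problem is needed.
  have hz := hv.residual hq
  have hz0 := residual_vertex hq v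
  set z := residual q v
  simp only [mul_one] at hZ hW
  have eZ : ∀ y ∈ gasket q, Z y = (1 / 5) ^ w.length * z y := fun y hy =>
    hz.eq_mul_of_const hq hz0 hZ hZ0 hy
  have eW : ∀ l, ∫ y in cut q (j l) (c l), W l y ∂mu q =
      (1 / 5) ^ w.length * ∫ y in cut q (j l) (c l), z y ∂mu q := fun l => by
    rw [← integral_const_mul]
    exact setIntegral_congr_fun (measurableSet_cut q _ _) fun y hy =>
      hz.eq_mul_of_const hq hz0 (hW l) (hW0 l) hy.1
  rw [integral_congr_gasket eZ, integral_const_mul, integral_torsion hq hz hz0, eZ ξ hξ] at heq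
  simp only [eW, one_mul, integral_hfun_single hq] at heq
  change cConst q v (shape q w c) (wordMap q w ξ) * _ = _ at heq
  -- `i` is the subcell of `C_w` that contains the point. The upper barrier holds there, and it
  -- involves just the `i`-th harmonic coordinate.
  obtain ⟨i, η, hη, rfl⟩ := exists_F_of_mem hξ
  have hcoord := harmonic_coordinate_eq hq hn c hξ hmean i
  have hzle := torsion_F_le hq hz hz0 i hη
  have hbd := fun l => cut_integral_bounds hq (j l) (c l)
  have hm1 : ∀ l, (mu q).real (cut q (j l) (c l)) ≤ 1 := fun l => measureReal_le_one
  have hzcut : ∀ l, -(1 / 6) * ((mu q).real (cut q (j l) (c l)) -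
      ∫ y in cut q (j l) (c l), hfun q (Pi.single (j l) 1) y ∂mu q) ≤
      ∫ y in cut q (j l) (c l), z y ∂mu q := by
    intro l
    have hi : IntegrableOn (hfun q (Pi.single (j l) 1)) (cut q (j l) (c l)) (mu q) :=
      (integrable_of_continuousOn (continuousOn_hfun hq (Pi.single (j l) 1))).integrableOn
    have hc1 : IntegrableOn (fun _ => (1 : ℝ)) (cut q (j l) (c l)) (mu q) :=
      (integrable_const (1 : ℝ)).integrableOn
    have h1 := setIntegral_mono_on ((hc1.sub hi).const_mul (-(1 / 6)))
      (integrable_of_continuousOn hz.cont).integrableOn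
      (measurableSet_cut q (j l) (c l)) fun y hy => torsion_barrier hq hz hz0 (j l) hy.1
    simp only [Pi.sub_apply] at h1
    rw [integral_const_mul, integral_sub hc1 hi] at h1
    simpa using h1
  set m : Fin 3 → ℝ := fun l => (mu q).real (cut q (j l) (c l)) with hm
  set p : Fin 3 → ℝ := fun l => ∫ y in cut q (j l) (c l), hfun q (Pi.single (j l) 1) y ∂mu q
    with hp
  set s : Fin 3 → ℝ := fun l => ∫ y in cut q (j l) (c l), z y ∂mu q with hs
  change ∀ l, 0 ≤ p l ∧ p l ≤ m l at hbd
  change ∀ l, m l ≤ 1 at hm1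
  change ∀ l, -(1 / 6) * (m l - p l) ≤ s l at hzcut
  change _ * (1 + ∑ i, m i) = (1 / 5) ^ w.length * -(1 / 18) +
    ∑ i, (1 / 2 * ((1 / 5) ^ w.length * (1 / 3 + 1 / 3)) * (m i - p i) +
      (1 / 5) ^ w.length * s i) - (1 / 5) ^ w.length * z (F q i η) * (1 + ∑ i, m i) at heq
  change hfun q (Pi.single i 1) (F q i η) * (1 + ∑ l, m l) = 1 / 3 + ∑ l,
    (if l = i then 2 * m l - p l else -(1 / 2) * (m l - p l)) at hcoord
  have hsum : ∀ f : Fin 3 → ℝ, ∑ l, f l = f i + f (i + 1) + f (i + 2) := by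
    intro f
    rw [Fin.sum_univ_three]
    fin_cases i <;> simp <;> ring
  simp only [hsum, if_true, if_neg (add_one_ne i), if_neg (add_two_ne i)] at heq hcoord
  have b0 := hbd i
  have b1 := hbd (i + 1)
  have b2 := hbd (i + 2)
  have t0 := hzcut i
  have t1 := hzcut (i + 1)
  have t2 := hzcut (i + 2)
  have u0 := hm1 i
  have u1 := hm1 (i + 1)
  have u2 := hm1 (i + 2)
  have hM1 : 1 ≤ 1 + (m i + m (i + 1) + m (i + 2)) := by linarith
  have hM4 : 1 + (m i + m (i + 1) + m (i + 2)) ≤ 4 := by linarith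
  set M := 1 + (m i + m (i + 1) + m (i + 2)) with hMdef
  set C := cConst q v (shape q w c) (wordMap q w (F q i η))
  set t := hfun q (Pi.single i 1) (F q i η)
  have hk : (0 : ℝ) < (1 / 5) ^ w.length := by positivity
  set K : ℝ := (1 / 5) ^ w.length
  have h1 : z (F q i η) * M ≤ -(1 / 9) * (M - t * M) := by nlinarith
  -- The coordinate formula gives `M - t M = 2/3 - (m_i - p_i)` plus nonnegative terms from the
  -- other two cuts. A ninth of this contributes `2/27 - (m_i - p_i)/9`. The cuts contribute at
  -- least `(m_i - p_i)/6`, and `2/27 - 1/18 = 1/54`.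
  have h2 : 1 / 54 ≤ -(1 / 18) + 1 / 3 * (m i - p i + (m (i + 1) - p (i + 1)) +
      (m (i + 2) - p (i + 2))) + (s i + s (i + 1) + s (i + 2)) - z (F q i η) * M := by
    linarith
  have h3 : K / 54 ≤ C * M := by
    rw [heq]
    have := mul_le_mul_of_nonneg_left h2 hk.le
    linarith
  have hC : 0 < C := by
    by_contra hneg
    have : C * M ≤ 0 := mul_nonpos_of_nonpos_of_nonneg (not_lt.1 hneg) (by linarith)
    linarith
  nlinarith

/-- In the exact formula the central integral is at most `Kε/4` with `K = 5^{-k}`, and each neighbor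
contributes at most `Kε + Kε/4`, in total `4Kε`. The value `Z ξ` costs a further `Kε/4`. -/
lemma abs_mean_sub_le (hq : Equilateral q) {w : List (Fin 3)}
    (hw : Disjoint (cell q w) (V q 0)) (c : Fin 3 → ℝ) {ξ : Plane} (hξ : ξ ∈ gasket q)
    (hB : ∀ f, IsHarmonic q f → mean q (shape q w c) f = f (wordMap q w ξ))
    {u g : Plane → ℝ} (hu : WeakLaplacian q u g) {ε : ℝ}
    (hε : ∀ v : List (Fin 3), v.length = w.length → (cell q v ∩ cell q w).Nonempty →
      ∀ y ∈ cell q v, |g y| ≤ ε) :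
    |mean q (shape q w c) u - u (wordMap q w ξ)| ≤ 5 * ε * (1 / 5) ^ w.length := by
  choose n j hn using exists_isNeighbor hq hw
  obtain ⟨Z, W, hZ, hZ0, hW, hW0, heq⟩ := mean_sub_eq hq hn c hB hu
  have hgw : ∀ y ∈ gasket q, |g (wordMap q w y)| ≤ ε := fun y hy =>
    hε w rfl (by rw [inter_self]; exact ⟨_, y, hy, rfl⟩) _ ⟨y, hy, rfl⟩
  have hgn : ∀ l, ∀ y ∈ gasket q, |g (wordMap q (n l) y)| ≤ ε := fun l y hy =>
    hε (n l) (hn l).length_eq ⟨wordMap q w (q l), ⟨q (j l), vertex_mem q _, (hn l).vertex_eq⟩,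
      q l, vertex_mem q l, rfl⟩ _ ⟨y, hy, rfl⟩
  have hε0 : 0 ≤ ε := (abs_nonneg _).trans (hgw _ (vertex_mem q 0))
  have hk : (0 : ℝ) < (1 / 5) ^ w.length := by positivity
  set K : ℝ := (1 / 5) ^ w.length
  have hscale : ∀ t : ℝ, |t| ≤ ε → |K * t| ≤ K * ε := fun t ht => by
    rw [abs_mul, abs_of_pos hk]; gcongr
  have bZ := hZ.abs_le_of_vertex_eq_zero hq hZ0 fun y hy => hscale _ (hgw y hy)
  have bW := fun l => (hW l).abs_le_of_vertex_eq_zero hq (hW0 l) fun y hy =>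
    hscale _ (hgn l y hy)
  have hKε : 0 ≤ K * ε / 4 := by positivity
  have bZi := abs_setIntegral_le hKε bZ univ
  rw [Measure.restrict_univ] at bZi
  have bterm : ∀ i, |1 / 2 * (K *
          ((∫ y, g (wordMap q w y) * hfun q (Pi.single i 1) y ∂mu q) +
            ∫ y, g (wordMap q (n i) y) * hfun q (Pi.single (j i) 1) y ∂mu q)) *
          ((mu q).real (cut q (j i) (c i)) -
            ∫ y in cut q (j i) (c i), hfun q (Pi.single (j i) 1) y ∂mu q) +
          ∫ y in cut q (j i) (c i), W i y ∂mu q| ≤ 5 / 4 * (K * ε) := by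
    intro i
    have h1 := abs_integral_mul_single_le hq (g := fun y => g (wordMap q w y)) hgw i
    have h2 := abs_integral_mul_single_le hq (g := fun y => g (wordMap q (n i) y)) (hgn i) (j i)
    have h3 := abs_setIntegral_le hKε (bW i) (cut q (j i) (c i))
    obtain ⟨h4, h5⟩ := cut_integral_bounds hq (j i) (c i)
    have h6 : (mu q).real (cut q (j i) (c i)) ≤ 1 := measureReal_le_one
    set I := ∫ y, g (wordMap q w y) * hfun q (Pi.single i 1) y ∂mu q
    set J := ∫ y, g (wordMap q (n i) y) * hfun q (Pi.single (j i) 1) y ∂mu q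
    set r := (mu q).real (cut q (j i) (c i)) -
      ∫ y in cut q (j i) (c i), hfun q (Pi.single (j i) 1) y ∂mu q
    have hr0 : 0 ≤ r := by simp only [r]; linarith
    have hr1 : r ≤ 1 := by simp only [r]; linarith
    have h7 : |1 / 2 * (K * (I + J)) * r| ≤ K * ε := by
      have h8 : |I + J| ≤ 2 * ε := (abs_add_le _ _).trans (by linarith)
      rw [abs_mul, abs_mul, abs_mul, abs_of_pos hk, abs_of_nonneg hr0,
        abs_of_pos (by norm_num : (0 : ℝ) < 1 / 2)]
      calc 1 / 2 * (K * |I + J|) * r ≤ 1 / 2 * (K * (2 * ε)) * 1 := by gcongr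
        _ = K * ε := by ring
    refine (abs_add_le _ _).trans ?_
    linarith
  have hsum := (Finset.abs_sum_le_sum_abs _ _).trans
    (Finset.sum_le_sum fun i (_ : i ∈ Finset.univ) => bterm i)
  rw [Finset.sum_const, Finset.card_univ, Fintype.card_fin, nsmul_eq_mul] at hsum
  have hM1 : 1 ≤ 1 + ∑ i, (mu q).real (cut q (j i) (c i)) := by
    have : 0 ≤ ∑ i, (mu q).real (cut q (j i) (c i)) := by positivity
    linarith
  set M := 1 + ∑ i, (mu q).real (cut q (j i) (c i))
  set D := mean q (shape q w c) u - u (wordMap q w ξ)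
  have hDZ : |(D + Z ξ) * M| ≤ 4 * (K * ε) := by
    rw [show (D + Z ξ) * M = D * M + Z ξ * M by ring, heq, sub_add_cancel]
    refine (abs_add_le _ _).trans ?_
    push_cast at hsum
    linarith
  have h1 : |D + Z ξ| ≤ 4 * (K * ε) := by
    rw [abs_mul, abs_of_pos (by linarith : 0 < M)] at hDZ
    have := abs_nonneg (D + Z ξ)
    nlinarith
  have h2 := abs_le.1 h1
  have h3 := abs_le.1 (bZ ξ hξ)
  have h4 : 0 ≤ K * ε := by positivity
  exact abs_le.2 ⟨by linarith, by linarith⟩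

end SG

end

/-! ### Conclusion: comparison of `u` with a multiple of `v`. -/

theorem theorem4p2 (q : Fin 3 → SG.Plane) (hq : SG.Equilateral q)
    -- `u ∈ dom Δ` with `Δ u = g`
    (u g : SG.Plane → ℝ) (hu : SG.HasLaplacian q u g)
    -- the Hölder condition
    (c γ : ℝ) (hγ0 : 0 < γ) (hγ1 : γ < 1)
    (hg : ∀ (k : ℕ) (w : List (Fin 3)), w.length = k →
      ∀ x ∈ SG.cell q w, ∀ y ∈ SG.cell q w, |g y - g x| ≤ c * γ ^ k)
    -- any `v` with `Δ v ≡ 1`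
    (v : SG.Plane → ℝ) (hv : SG.HasLaplacian q v fun _ => 1)
    -- a point off the boundary, and a system of mean value neighborhoods of it
    (x : SG.Plane) (hx : x ∈ SG.gasket q \ SG.V q 0)
    (B : ℕ → Set SG.Plane) (k₀ : ℕ) (hB : ∀ k ≥ k₀, SG.IsMeanValueNhd q k x (B k)) :
    (∀ k ≥ k₀, SG.cConst q v (B k) x ≠ 0) ∧
      Tendsto (fun k => (SG.mean q (B k) u - u x) / SG.cConst q v (B k) x) atTop (𝓝 (g x)) := by
  have hu' := hu.weakLaplacian hq
  have hv' := hv.weakLaplacian hq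
  have hlow : ∀ k ≥ k₀, (1 / 5) ^ k / 216 ≤ SG.cConst q v (B k) x := fun k hk =>
    SG.cConst_lower_bound hq (hB k hk) hv'
  have hpos : ∀ k ≥ k₀, 0 < SG.cConst q v (B k) x := fun k hk =>
    lt_of_lt_of_le (by positivity) (hlow k hk)
  refine ⟨fun k hk => (hpos k hk).ne', ?_⟩
  -- Subtracting `g x` times `v` makes the Laplacian vanish at `x`, and the subtracted part
  -- contributes exactly `g x` times `c_B` to the defect.
  have hU := hu'.add_mul hq hv' (-g x)
  have key : ∀ k ≥ k₀, |(SG.mean q (B k) u - u x) - g x * SG.cConst q v (B k) x| ≤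
      5 * (2 * (c * γ ^ k)) * (1 / 5) ^ k := by
    intro k hk
    obtain ⟨w, rfl, hxw, hw, ⟨a, -, hBa⟩, hmean⟩ := hB k hk
    rw [hBa] at hmean
    rw [SG.cConst, hBa]
    obtain ⟨ξ, hξ, rfl⟩ := hxw
    have h := SG.abs_mean_sub_le hq hw a hξ hmean hU (ε := 2 * (c * γ ^ w.length)) ?_
    · rw [SG.mean_add_mul hu'.cont hv'.cont] at h
      refine le_of_eq_of_le (congrArg _ ?_) h
      ring
    -- A point `y` of a cell meeting `C_w` is compared with `x` through a common point `p`, which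
    -- costs the oscillation bound twice.
    · rintro n hn ⟨p, hpn, hpw⟩ y hy
      have h1 := abs_le.1 (hg _ n hn p hpn y hy)
      have h2 := abs_le.1 (hg _ w rfl _ (Set.mem_image_of_mem _ hξ) p hpw)
      exact abs_le.2 ⟨by linarith, by linarith⟩
  have herr : ∀ k ≥ k₀, |(SG.mean q (B k) u - u x) / SG.cConst q v (B k) x - g x| ≤
      2160 * c * γ ^ k := by
    intro k hk
    have hC := hpos k hk
    have h5 : (0 : ℝ) < (1 / 5) ^ k := by positivity
    have hc : 0 ≤ c * γ ^ k := (abs_nonneg _).trans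
      (hg k (List.replicate k 0) List.length_replicate _ ⟨_, SG.vertex_mem q 0, rfl⟩ _
        ⟨_, SG.vertex_mem q 0, rfl⟩)
    have heq : (SG.mean q (B k) u - u x) / SG.cConst q v (B k) x - g x =
        ((SG.mean q (B k) u - u x) - g x * SG.cConst q v (B k) x) / SG.cConst q v (B k) x := by
      field_simp
    rw [heq, abs_div, abs_of_pos hC, div_le_iff₀ hC]
    refine (key k hk).trans ?_
    -- `2160 = 5 · 2 · 216`; the factors `5^{-k}` of the two bounds cancel.
    have := mul_le_mul_of_nonneg_left (hlow k hk) (by linarith : 0 ≤ 2160 * (c * γ ^ k))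
    linarith
  rw [tendsto_iff_norm_sub_tendsto_zero]
  refine squeeze_zero' (Eventually.of_forall fun _ => norm_nonneg _)
    ((eventually_ge_atTop k₀).mono fun k hk => herr k hk) ?_
  simpa using (tendsto_pow_atTop_nhds_zero_of_lt_one hγ0.le hγ1).const_mul (2160 * c)
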